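/- Let $\mathcal X$ be a separable real Hilbert space with orthonormal basis $\phi_1,\phi_2,\dots$ (finite or infinite), let $d(n)$ be positive integers with $d(n)\le\dim\mathcal X$, let $\mathcal Z_n=\operatorname{span}\{\phi_1,\dots,\phi_{d(n)}\}$, and for $z\in\mathcal X$ put $z^{(n)}=\sum_{k\le d(n)}\langle\phi_k,z\rangle\phi_k$. Let $X_1,X_2,\dots$ be i.i.d. random elements of $\mathcal X$ with law $\mu$, let $X\sim\mu$, and let $u\in\mathcal X$ with $\|u\|<1$. In expressions $v/\|v\|$ we use the convention $0/\|0\|=0$. Assume (B) $\mu$ is nonatomic (that is, $\mu(\{x\})=0$ for every $x\in\mathcal X$) and is not entirely supported on a line $\{a x_1+(1-a)x_2:a\in\mathbb R\}$, $x_1\neq x_2$; and for every $C>0$ we have, for all sufficiently large $n$, $\sup_{Q\in\mathcal Z_n,\ \|Q\|\le C}E\{\|Q-X^{(n)}\|^{-2}\}<\infty$ (with $1/0=\infty$). Suppose that for some $\alpha\in(0,1/2]$ the sequence $d(n)/n^{1-2\alpha}$ tends to a positive constant as $n\to\infty$. For $Q\in\mathcal Z_n$ put $$g_n(Q)=E\{\|Q-X^{(n)}\|-\|X^{(n)}\|\}-\langle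 u^{(n)},Q\rangle,\qquad \widehat g_n(Q)=\frac1n\sum_{i=1}^n\{\|Q-X_i^{(n)}\|-\|X_i^{(n)}\|\}-\langle u^{(n)},Q\rangle .$$ Then: 1. For all sufficiently large $n$, $g_n$ has a unique minimizer $Q_n(u)$ over $\mathcal Z_n$; for every $n\ge1$ and every realization of the sample, $\widehat g_n$ has a minimizer over $\mathcal Z_n$. 2. For all sufficiently large $n$, $g_n$ has a Hessian at $Q_n(u)$, in the sense that there is a symmetric continuous linear operator $\widetilde J_n=\widetilde J_{n,Q_n(u)}:\mathcal Z_n\to\mathcal Z_n$ such that for every $h\in\mathcal Z_n$, with $Q=Q_n(u)$, $$\lim_{t\to0}\frac1{t^2}\left|g_n(Q+th)-g_n(Q)-t\left\langle E\left\{\frac{Q-X^{(n)}}{\|Q-X^{(n)}\|}-u^{(n)}\right\},h\right\rangle-\frac{t^2}{2}\langle\widetilde J_n h,h\rangle\right|=0,$$ and $\widetilde J_n$ is invertible on $\mathcal Z_n$. 3. Let $\widehat Q_n(u)\in\mathcal Z_n$ be any choice of sample spatial $u$-quantiles, that is, of elements of $\mathcal Z_n$ such that almost surely $\widehat Q_n(u)$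 minimizes $\widehat g_n$ over $\mathcal Z_n$ for all sufficiently large $n$. Then, for all sufficiently large $n$, $$\widehat Q_n(u)-Q_n(u)=-\frac1n\sum_{i=1}^n\widetilde J_n^{-1}\left(\frac{Q_n(u)-X_i^{(n)}}{\|Q_n(u)-X_i^{(n)}\|}-u^{(n)}\right)+R_n,$$ where, almost surely, $\|R_n\|=O\big((\ln n)/n^{2\alpha}\big)$ as $n\to\infty$. -/

import Mathlib

open MeasureTheory ProbabilityTheory Filter Topology Asymptotics
open scoped ENNReal

noncomputable section

namespace SpatialQuantile

variable {H : Type*} [NormedAddCommGroup H] [InnerProductSpace ℝ H]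

/-- `φ 0, φ 1, …` (the terms with index `< N`) is an orthonormal basis of the Hilbert space `H`.
Here `N = ⊤` when `H` is infinite dimensional, and `N = dim H` otherwise; the values `φ k`
with `k ≥ N` play no role. -/
structure IsOrthonormalBasisSeq (N : ℕ∞) (φ : ℕ → H) : Prop where
  orthonormal : Orthonormal ℝ (fun k : {k : ℕ // (k : ℕ∞) < N} => φ k)
  total : (Submodule.span ℝ (φ '' {k : ℕ | (k : ℕ∞) < N})).topologicalClosure = ⊤

/-- The space spanned by the first `m` basis vectors. -/
abbrev Zspan (φ : ℕ → H) (m : ℕ) : Submodule ℝ H :=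
  Submodule.span ℝ (φ '' {k : ℕ | k < m})

/-- The truncation `∑_{k < m} ⟪φ k, z⟫ φ k` of the expansion of `z` in the basis `φ`,
as an element of the space spanned by the first `m` basis vectors. -/
def trunc (φ : ℕ → H) (m : ℕ) (z : H) : Zspan φ m :=
  ⟨∑ k ∈ Finset.range m, (inner ℝ (φ k) z) • φ k,
    Submodule.sum_mem _ fun k hk => Submodule.smul_mem _ _
      (Submodule.subset_span ⟨k, Finset.mem_range.mp hk, rfl⟩)⟩

/-- The sign map `x ↦ x / ‖x‖` of a Hilbert space, with value `0` at `0`. -/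
def sgn {E : Type*} [NormedAddCommGroup E] [InnerProductSpace ℝ E] (x : E) : E :=
  ‖x‖⁻¹ • x

/-- `n⁻¹ ∑_{i < n} (‖Q - X_i^{(n)}‖ - ‖X_i^{(n)}‖) - u^{(n)}(Q)` for `Q` in the span of the
first `m = d(n)` basis vectors, where `x i` is the observed value of `X_i`. -/
def sampleObjective (φ : ℕ → H) (m : ℕ) (u : H) (n : ℕ) (x : ℕ → H) (Q : Zspan φ m) : ℝ :=
  (n : ℝ)⁻¹ * (∑ i ∈ Finset.range n, (‖Q - trunc φ m (x i)‖ - ‖trunc φ m (x i)‖))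
    - inner ℝ (trunc φ m u) Q

/-- `Q` minimizes the sample objective function over the span of the first `m = d(n)` basis
vectors, i.e. `Q` is a sample spatial `u`-quantile of `x 0, …, x (n - 1)`. -/
def IsSampleQuantile (φ : ℕ → H) (m : ℕ) (u : H) (n : ℕ) (x : ℕ → H) (Q : Zspan φ m) : Prop :=
  ∀ Q' : Zspan φ m, sampleObjective φ m u n x Q ≤ sampleObjective φ m u n x Q'

variable [MeasurableSpace H]

/-- `g_n(Q) = E{‖Q - X^{(n)}‖ - ‖X^{(n)}‖} - u^{(n)}(Q)` for `Q` in the span of the first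
`m = d(n)` basis vectors, `X` having law `μ`. -/
def popObjective (μ : Measure H) (φ : ℕ → H) (m : ℕ) (u : H) (Q : Zspan φ m) : ℝ :=
  (∫ x, (‖Q - trunc φ m x‖ - ‖trunc φ m x‖) ∂μ) - inner ℝ (trunc φ m u) Q

/-- `Q` minimizes the objective function `g_n` over the span of the first `m = d(n)` basis
vectors, i.e. `Q = Q_n(u)`. -/
def IsPopQuantile (μ : Measure H) (φ : ℕ → H) (m : ℕ) (u : H) (Q : Zspan φ m) : Prop :=
  ∀ Q' : Zspan φ m, popObjective μ φ m u Q ≤ popObjective μ φ m u Q'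

/-- `E{(Q - X^{(n)}) / ‖Q - X^{(n)}‖ - u^{(n)}}`, a Bochner expectation. -/
def popGradient (μ : Measure H) (φ : ℕ → H) (m : ℕ) (u : H) (Q : Zspan φ m) : Zspan φ m :=
  ∫ x, (sgn (Q - trunc φ m x) - trunc φ m u) ∂μ

/-- `J` is the continuous linear operator associated with the Hessian of `g_n` at `Q`: it is
symmetric, and the bilinear form `⟪J h, v⟫` gives the second order term of the expansion of
`g_n` at `Q` along every line. -/
structure IsHessianOperator (μ : Measure H) (φ : ℕ → H) (m : ℕ) (u : H) (Q : Zspan φ m)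
    (J : Zspan φ m →L[ℝ] Zspan φ m) : Prop where
  symm : ∀ h v : Zspan φ m, inner ℝ (J h) v = inner ℝ (J v) h
  expansion : ∀ h : Zspan φ m,
    Tendsto (fun t : ℝ =>
      |popObjective μ φ m u (Q + t • h) - popObjective μ φ m u Q
        - t * inner ℝ (popGradient μ φ m u Q) h
        - t ^ 2 / 2 * inner ℝ (J h) h| / t ^ 2) (𝓝[≠] 0) (𝓝 0)

/-- The nonatomicity, no-line and negative-moment conditions on `μ`. In the last one, the
expectation of `‖Q - X^{(n)}‖⁻²` takes values in `[0, ∞]`, with `1 / 0 = ∞`. -/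
structure AssumptionB (μ : Measure H) (φ : ℕ → H) (d : ℕ → ℕ) : Prop where
  nonatomic : ∀ x : H, μ {x} = 0
  not_line : ∀ x₁ x₂ : H, x₁ ≠ x₂ →
    ¬ ∀ᵐ x ∂μ, ∃ a : ℝ, x = a • x₁ + (1 - a) • x₂
  moment : ∀ C : ℝ, 0 < C → ∀ᶠ n : ℕ in atTop,
    (⨆ (Q : Zspan φ (d n)) (_ : ‖Q‖ ≤ C),
      ∫⁻ x, (‖Q - trunc φ (d n) x‖ₑ ^ 2)⁻¹ ∂μ) < ∞

end SpatialQuantile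

end

open SpatialQuantile

/-!
Write `G Q = E sgn (Q - X^{(n)})`, so that `G Q - u^{(n)}` is the gradient of `g_n`, and let `Ĝ` be
its empirical counterpart.

Distances shrink under coordinate projections, so among the indices for which the negative moment
is finite one of the smallest dimension provides a bound `K` valid for all larger `n`
(`AssumptionB.exists_invSqMomentLE`). This one bound has two consequences which are uniform in the
growing dimension. The second derivative of the sign map is of the order `‖a‖⁻²`, so `G` is
differentiable with a quadratic remainder (`InvSqMomentLE.norm_meanSgn_add_sub_sub_le`). And every
ball of radius `r` has mass at most `K r²`, so thin tubes around lines have small mass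
(`InvSqMomentLE.measureReal_tube_le`); away from such a tube the sign map is strongly monotone along
the line, hence so is `G` on balls (`InvSqMomentLE.le_inner_meanSgn_sub`). Strong monotonicity
gives the uniqueness of the population quantile and a lower bound `κ` for the Hessian; coercivity
keeps the quantiles in a fixed ball (`AssumptionB.exists_uniformBounds`).

For the sample let `δ = √(ln n / n ^ (2 α))`. The space `Z_n` has a dimension of the order
`n δ² / ln n`, so a `1 / n`-net of its unit ball has at most `exp (O(n δ²))` points. A Bernstein
bound (`measureReal_empirical_ge_le`), a union bound over the net, and Borel-Cantelli show that
almost surely, for large `n`, `Ĝ - G` is `O(δ)` at the population quantile, while its oscillation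
over the ball of radius `O(δ)` is `O(δ²)`, and so is the proportion of observations coinciding
with a point of that ball (`NetClose`, `measureReal_not_netClose_le`). On this event convexity and
strong monotonicity force the sample quantile into that ball. There `Ĝ - u^{(n)}` vanishes up to the
proportion of coincidences, and replacing `G` by its linearization costs another `O(δ²)`
(`NetClose.norm_linearization_le`). Inverting the Hessian gives the representation.
-/

noncomputable section

set_option linter.unusedSectionVars false

namespace SpatialQuantile

/-! ### The sign map and its derivative -/

section Pointwise

variable {E : Type*} [NormedAddCommGroup E] [InnerProductSpace ℝ E]

lemma sgn_zero : sgn (0 : E) = 0 := by simp [sgn]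

lemma norm_sgn {a : E} (ha : a ≠ 0) : ‖sgn a‖ = 1 := by
  rw [sgn, norm_smul, norm_inv, norm_norm, inv_mul_cancel₀ (norm_ne_zero_iff.2 ha)]

lemma norm_sgn_le_one (a : E) : ‖sgn a‖ ≤ 1 := by
  rcases eq_or_ne a 0 with rfl | ha
  · simp [sgn_zero]
  · exact (norm_sgn ha).le

lemma norm_smul_sgn (a : E) : ‖a‖ • sgn a = a := by
  rcases eq_or_ne a 0 with rfl | ha
  · simp
  · rw [sgn, smul_smul, mul_inv_cancel₀ (norm_ne_zero_iff.2 ha), one_smul]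

lemma inner_sgn_self (a : E) : inner ℝ (sgn a) a = ‖a‖ := by
  rcases eq_or_ne a 0 with rfl | ha
  · simp
  · rw [sgn, real_inner_smul_left, real_inner_self_eq_norm_sq]
    have := norm_ne_zero_iff.2 ha
    field_simp

lemma inner_sgn_le (a h : E) : inner ℝ (sgn a) h ≤ ‖h‖ :=
  (real_inner_le_norm _ _).trans
    (mul_le_of_le_one_left (norm_nonneg _) (norm_sgn_le_one a))

lemma norm_sgn_sub_sgn_le {a : E} (ha : a ≠ 0) (b : E) :
    ‖sgn b - sgn a‖ ≤ 2 * ‖b - a‖ / ‖a‖ := by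
  have hA : 0 < ‖a‖ := norm_pos_iff.2 ha
  rw [le_div_iff₀ hA]
  have h1 : ‖a‖ • (sgn b - sgn a) = (b - a) + (‖a‖ - ‖b‖) • sgn b := by
    rw [smul_sub, norm_smul_sgn, sub_smul, norm_smul_sgn]; abel
  have h2 : ‖sgn b - sgn a‖ * ‖a‖ = ‖‖a‖ • (sgn b - sgn a)‖ := by
    rw [norm_smul, norm_norm, mul_comm]
  rw [h2, h1]
  refine (norm_add_le _ _).trans ?_
  rw [norm_smul, Real.norm_eq_abs]
  have h3 : |‖a‖ - ‖b‖| ≤ ‖b - a‖ := by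
    rw [norm_sub_rev]; exact abs_norm_sub_norm_le a b
  nlinarith [norm_sgn_le_one b, abs_nonneg (‖a‖ - ‖b‖), norm_nonneg (sgn b)]

/-- `sgn a` is a subgradient of the norm at `a`, also for `a = 0`. -/
lemma norm_add_inner_sgn_le (a h : E) : ‖a‖ + inner ℝ (sgn a) h ≤ ‖a + h‖ := by
  have := inner_sgn_le a (a + h)
  rwa [inner_add_right, inner_sgn_self] at this

lemma norm_add_le_inner_sgn {a : E} (ha : a ≠ 0) (h : E) :
    ‖a + h‖ ≤ ‖a‖ + inner ℝ (sgn a) h + 2 * ‖h‖ ^ 2 / ‖a‖ := by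
  have h1 := norm_add_inner_sgn_le (a + h) (-h)
  rw [inner_neg_right, add_neg_cancel_right] at h1
  have h2 : inner ℝ (sgn (a + h) - sgn a) h ≤ 2 * ‖h‖ ^ 2 / ‖a‖ := by
    refine (real_inner_le_norm _ _).trans ?_
    have := norm_sgn_sub_sgn_le ha (a + h)
    rw [add_sub_cancel_left] at this
    calc _ ≤ 2 * ‖h‖ / ‖a‖ * ‖h‖ := by gcongr
      _ = _ := by ring
  rw [inner_sub_left] at h2
  linarith

/-- The derivative `h ↦ (h - ⟪a, h⟫ a / ‖a‖²) / ‖a‖` of the sign map at `a`, which is also the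
Hessian of the norm; it has the value `0` at `a = 0`. -/
def sgnDeriv (a : E) : E →L[ℝ] E :=
  ‖a‖⁻¹ • (ContinuousLinearMap.id ℝ E - (innerSL ℝ (sgn a)).smulRight (sgn a))

lemma sgnDeriv_apply (a h : E) :
    sgnDeriv a h = ‖a‖⁻¹ • (h - (inner ℝ (sgn a) h : ℝ) • sgn a) := by
  simp [sgnDeriv]

lemma inner_sgnDeriv (a h v : E) : inner ℝ (sgnDeriv a h) v =
    ‖a‖⁻¹ * (inner ℝ h v - inner ℝ (sgn a) h * inner ℝ (sgn a) v) := by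
  rw [sgnDeriv_apply, real_inner_smul_left, inner_sub_left, real_inner_smul_left]

lemma norm_sgnDeriv_le (a : E) : ‖sgnDeriv a‖ ≤ 2 * ‖a‖⁻¹ := by
  refine ContinuousLinearMap.opNorm_le_bound _ (by positivity) fun h => ?_
  rw [sgnDeriv_apply, norm_smul, norm_inv, norm_norm]
  have h1 : ‖h - (inner ℝ (sgn a) h : ℝ) • sgn a‖ ≤ 2 * ‖h‖ := by
    refine (norm_sub_le _ _).trans ?_
    rw [norm_smul]
    have h2 : ‖(inner ℝ (sgn a) h : ℝ)‖ ≤ ‖h‖ := (norm_inner_le_norm _ _).trans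
      (mul_le_of_le_one_left (norm_nonneg _) (norm_sgn_le_one a))
    nlinarith [norm_sgn_le_one a, norm_nonneg (sgn a), norm_nonneg (inner ℝ (sgn a) h : ℝ)]
  calc _ ≤ ‖a‖⁻¹ * (2 * ‖h‖) := by gcongr
    _ = _ := by ring

/-- First order Taylor expansion of the sign map, with a remainder of the order of `‖a‖⁻²`. -/
lemma norm_sgn_add_sub_sub_le {a : E} (ha : a ≠ 0) (h : E) :
    ‖sgn (a + h) - sgn a - sgnDeriv a h‖ ≤ 4 * ‖h‖ ^ 2 / ‖a‖ ^ 2 := by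
  have hA : 0 < ‖a‖ := norm_pos_iff.2 ha
  set p : ℝ := inner ℝ (sgn a) h with hp
  have key : ‖a‖ • (sgn (a + h) - sgn a - sgnDeriv a h)
      = p • (sgn a - sgn (a + h)) - (‖a + h‖ - ‖a‖ - p) • sgn (a + h) := by
    rw [sgnDeriv_apply, smul_sub, smul_sub, norm_smul_sgn, smul_smul, mul_inv_cancel₀ hA.ne',
      one_smul, ← hp]
    have h1 : ‖a + h‖ • sgn (a + h) = a + h := norm_smul_sgn _
    rw [sub_smul, sub_smul, h1, smul_sub]
    abel
  have h1 : |p| ≤ ‖h‖ := (abs_real_inner_le_norm _ _).trans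
      (mul_le_of_le_one_left (norm_nonneg _) (norm_sgn_le_one a))
  have h2 : |‖a + h‖ - ‖a‖ - p| ≤ 2 * ‖h‖ ^ 2 / ‖a‖ := by
    rw [abs_le]
    have e1 := norm_add_inner_sgn_le a h
    have e2 := norm_add_le_inner_sgn ha h
    have e3 : 0 ≤ 2 * ‖h‖ ^ 2 / ‖a‖ := by positivity
    constructor <;> linarith
  have h3 : ‖sgn a - sgn (a + h)‖ ≤ 2 * ‖h‖ / ‖a‖ := by
    have := norm_sgn_sub_sgn_le ha (a + h)
    rwa [add_sub_cancel_left, norm_sub_rev] at this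
  have h4 : ‖a‖ * ‖sgn (a + h) - sgn a - sgnDeriv a h‖ ≤ 4 * ‖h‖ ^ 2 / ‖a‖ := by
    calc _ = ‖‖a‖ • (sgn (a + h) - sgn a - sgnDeriv a h)‖ := by rw [norm_smul, norm_norm]
      _ ≤ |p| * ‖sgn a - sgn (a + h)‖ + |‖a + h‖ - ‖a‖ - p| * ‖sgn (a + h)‖ := by
          rw [key]
          refine (norm_sub_le _ _).trans ?_
          rw [norm_smul, norm_smul, Real.norm_eq_abs, Real.norm_eq_abs]
      _ ≤ ‖h‖ * (2 * ‖h‖ / ‖a‖) + 2 * ‖h‖ ^ 2 / ‖a‖ * 1 := by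
          gcongr
          exact norm_sgn_le_one _
      _ = _ := by ring
  rw [le_div_iff₀ (by positivity)]
  rw [le_div_iff₀ hA] at h4
  linarith

/-- Second order Taylor expansion of the norm, with a remainder of the order of `‖a‖⁻²`. -/
lemma abs_norm_add_sub_le {a : E} (ha : a ≠ 0) (h : E) :
    |‖a + h‖ - ‖a‖ - inner ℝ (sgn a) h - 2⁻¹ * inner ℝ (sgnDeriv a h) h|
      ≤ 8 * ‖h‖ ^ 3 / ‖a‖ ^ 2 := by
  have hA : 0 < ‖a‖ := norm_pos_iff.2 ha
  set p : ℝ := inner ℝ (sgn a) h with hp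
  have h1 : |p| ≤ ‖h‖ := (abs_real_inner_le_norm _ _).trans
      (mul_le_of_le_one_left (norm_nonneg _) (norm_sgn_le_one a))
  have hD : inner ℝ (sgnDeriv a h) h = (‖h‖ ^ 2 - p ^ 2) / ‖a‖ := by
    rw [inner_sgnDeriv, real_inner_self_eq_norm_sq, ← hp]; ring
  have hq : 0 ≤ ‖h‖ ^ 2 - p ^ 2 := by
    have := sq_abs p
    nlinarith [abs_nonneg p]
  have hq' : ‖h‖ ^ 2 - p ^ 2 ≤ ‖h‖ ^ 2 := by nlinarith
  have hr : ‖a + h‖ ^ 2 = (‖a‖ + p) ^ 2 + (‖h‖ ^ 2 - p ^ 2) := by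
    rw [norm_add_sq_real]
    have : inner ℝ a h = ‖a‖ * p := by
      conv_lhs => rw [← norm_smul_sgn a]
      rw [real_inner_smul_left]
    rw [this]; ring
  have e1 := norm_add_inner_sgn_le a h
  have e2 := norm_add_le_inner_sgn ha h
  rw [hD, le_div_iff₀ (by positivity)]
  obtain ⟨hp1, hp2⟩ := abs_le.1 h1
  have hr0 := norm_nonneg (a + h)
  have hh0 := norm_nonneg h
  have htri := abs_norm_sub_norm_le (a + h) a
  rw [add_sub_cancel_left] at htri
  obtain ⟨ht1, ht2⟩ := abs_le.1 htri
  generalize ‖a + h‖ = r at *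
  generalize ‖h‖ = s at *
  generalize ‖a‖ = A at *
  rcases le_total A (2 * s) with hs | hs
  · have e3 : |r - A - p - 2⁻¹ * ((s ^ 2 - p ^ 2) / A)| ≤ 2 * s ^ 2 / A := by
      have : (s ^ 2 - p ^ 2) / A ≤ s ^ 2 / A := by gcongr
      have h0 : 0 ≤ (s ^ 2 - p ^ 2) / A := by positivity
      have h00 : 2 * s ^ 2 / A = 2 * (s ^ 2 / A) := by ring
      rw [abs_le]; constructor <;> linarith
    calc _ ≤ 2 * s ^ 2 / A * A ^ 2 := by gcongr
      _ = 2 * s ^ 2 * A := by field_simp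
      _ ≤ 2 * s ^ 2 * (2 * s) := by gcongr
      _ ≤ 8 * s ^ 3 := by nlinarith [pow_nonneg hh0 3]
  · set q := s ^ 2 - p ^ 2 with hqdef
    have hden : A ≤ r + A + p := by linarith
    have hden0 : 0 < r + A + p := by linarith
    have e3 : r - A - p = q / (r + A + p) := by
      rw [eq_div_iff hden0.ne']; nlinarith
    have e4 : r - A - p - 2⁻¹ * (q / A) = q * (A - r - p) / (2 * A * (r + A + p)) := by
      rw [e3]; field_simp; ring
    rw [e4, abs_div, abs_mul, abs_of_nonneg hq,
      abs_of_pos (show 0 < 2 * A * (r + A + p) by positivity)]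
    have e5 : |A - r - p| ≤ 2 * s := by rw [abs_le]; constructor <;> linarith
    calc q * |A - r - p| / (2 * A * (r + A + p)) * A ^ 2
        ≤ s ^ 2 * (2 * s) / (2 * A * A) * A ^ 2 := by gcongr
      _ = s ^ 3 := by field_simp
      _ ≤ 8 * s ^ 3 := by nlinarith [pow_nonneg hh0 3]

lemma inner_sgn_sub_sgn_nonneg (a b : E) : 0 ≤ inner ℝ (sgn b - sgn a) (b - a) := by
  have h1 := norm_add_inner_sgn_le a (b - a)
  have h2 := norm_add_inner_sgn_le b (a - b)
  rw [add_sub_cancel] at h1 h2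
  rw [← neg_sub b a, inner_neg_right] at h2
  rw [inner_sub_left]; linarith

/-- Quantitative monotonicity of the sign map: if the line through `a` and `b` stays at distance
at least `ε` from the origin, then the sign map is strongly monotone along that line. -/
lemma le_inner_sgn_sub_sgn {a b : E} {R ε : ℝ} (ha : ‖a‖ ≤ R) (hb : ‖b‖ ≤ R) (hε : 0 < ε)
    (hline : ε ^ 2 * ‖b - a‖ ^ 2 ≤ ‖a‖ ^ 2 * ‖b - a‖ ^ 2 - inner ℝ a (b - a) ^ 2) :
    ε ^ 2 / R ^ 3 * ‖b - a‖ ^ 2 ≤ inner ℝ (sgn b - sgn a) (b - a) := by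
  rcases eq_or_ne a b with rfl | hab
  · simp
  have hba : 0 < ‖b - a‖ := norm_pos_iff.2 (sub_ne_zero.2 hab.symm)
  have hgram : ‖a‖ ^ 2 * ‖b - a‖ ^ 2 - inner ℝ a (b - a) ^ 2
      = ‖a‖ ^ 2 * ‖b‖ ^ 2 - inner ℝ a b ^ 2 := by
    rw [inner_sub_right, real_inner_self_eq_norm_sq, norm_sub_sq_real, real_inner_comm]; ring
  rw [hgram] at hline
  have hpos : 0 < ‖a‖ ^ 2 * ‖b‖ ^ 2 - inner ℝ a b ^ 2 := lt_of_lt_of_le (by positivity) hline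
  have hA : 0 < ‖a‖ := by
    rcases (norm_nonneg a).eq_or_lt with h | h
    · rw [← h] at hpos; nlinarith [sq_nonneg (inner ℝ a b : ℝ)]
    · exact h
  have hB : 0 < ‖b‖ := by
    rcases (norm_nonneg b).eq_or_lt with h | h
    · rw [← h] at hpos; nlinarith [sq_nonneg (inner ℝ a b : ℝ)]
    · exact h
  have hlhs : inner ℝ (sgn b - sgn a) (b - a)
      = (‖a‖⁻¹ + ‖b‖⁻¹) * (‖a‖ * ‖b‖ - inner ℝ a b) := by
    rw [inner_sub_left, inner_sub_right, inner_sub_right, inner_sgn_self, inner_sgn_self,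
      sgn, sgn, real_inner_smul_left, real_inner_smul_left, real_inner_comm a b]
    field_simp; ring
  rw [hlhs]
  have hp := abs_le.1 (abs_real_inner_le_norm a b)
  have hp1 := hp.1
  have hp2 := hp.2
  generalize (inner ℝ a b : ℝ) = p at *
  generalize ‖b - a‖ = s at *
  generalize ‖a‖ = A at *
  generalize ‖b‖ = B at *
  have hR : 0 < R := hA.trans_le ha
  have h1 : ε ^ 2 * s ^ 2 / (2 * (R * R)) ≤ A * B - p := by
    have : ε ^ 2 * s ^ 2 ≤ (A * B - p) * (2 * (A * B)) := by nlinarith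
    calc _ ≤ ε ^ 2 * s ^ 2 / (2 * (A * B)) := by gcongr
      _ ≤ _ := by rwa [div_le_iff₀ (by positivity)]
  have h2 : 2 * R⁻¹ ≤ A⁻¹ + B⁻¹ := by
    have e1 : R⁻¹ ≤ A⁻¹ := by gcongr
    have e2 : R⁻¹ ≤ B⁻¹ := by gcongr
    linarith
  calc _ = 2 * R⁻¹ * (ε ^ 2 * s ^ 2 / (2 * (R * R))) := by field_simp
    _ ≤ _ := by gcongr

end Pointwise

/-! ### Negative moments and the mean sign vector -/

section Moments

variable {E : Type*} [NormedAddCommGroup E] [InnerProductSpace ℝ E]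
  {S : Type*} [MeasurableSpace S]

/-- `E‖Q - Y‖⁻² ≤ K` for all `Q` in the ball of radius `C`, where the expectation is an
extended nonnegative number, so that the bound forces `Y ≠ Q` almost surely. -/
def InvSqMomentLE (μ : Measure S) (Y : S → E) (C K : ℝ) : Prop :=
  ∀ Q : E, ‖Q‖ ≤ C → ∫⁻ x, (‖Q - Y x‖ₑ ^ 2)⁻¹ ∂μ ≤ ENNReal.ofReal K

variable {μ : Measure S} {Y : S → E} {C K : ℝ}

lemma InvSqMomentLE.mono (hK : InvSqMomentLE μ Y C K) {C' : ℝ} (hC : C' ≤ C) :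
    InvSqMomentLE μ Y C' K := fun Q hQ => hK Q (hQ.trans hC)

lemma stronglyMeasurable_sub (hY : StronglyMeasurable Y) (Q : E) :
    StronglyMeasurable fun x => Q - Y x := stronglyMeasurable_const.sub hY

lemma stronglyMeasurable_sgn_comp {f : S → E} (hf : StronglyMeasurable f) :
    StronglyMeasurable fun x => sgn (f x) :=
  StronglyMeasurable.smul (hf.norm.measurable.inv.stronglyMeasurable) hf

lemma measurable_inv_sq (hY : StronglyMeasurable Y) (Q : E) :
    Measurable fun x => (‖Q - Y x‖ₑ ^ 2)⁻¹ :=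
  ((stronglyMeasurable_sub hY Q).enorm.pow_const 2).inv

lemma InvSqMomentLE.ae_ne (hK : InvSqMomentLE μ Y C K) (hY : StronglyMeasurable Y) {Q : E}
    (hQ : ‖Q‖ ≤ C) : ∀ᵐ x ∂μ, Q - Y x ≠ 0 := by
  have h := ae_lt_top (measurable_inv_sq hY Q) ((hK Q hQ).trans_lt ENNReal.ofReal_lt_top).ne
  filter_upwards [h] with x hx h0
  simp [h0] at hx

lemma InvSqMomentLE.integrable_inv_sq (hK : InvSqMomentLE μ Y C K) (hY : StronglyMeasurable Y)
    {Q : E} (hQ : ‖Q‖ ≤ C) : Integrable (fun x => (‖Q - Y x‖ ^ 2)⁻¹) μ ∧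
      (0 ≤ K → ∫ x, (‖Q - Y x‖ ^ 2)⁻¹ ∂μ ≤ K) := by
  have hm : Measurable fun x => (‖Q - Y x‖ ^ 2)⁻¹ :=
    ((stronglyMeasurable_sub hY Q).norm.measurable.pow_const 2).inv
  have h0 : ∀ x, 0 ≤ (‖Q - Y x‖ ^ 2)⁻¹ := fun x => by positivity
  have heq : ∫⁻ x, ENNReal.ofReal ((‖Q - Y x‖ ^ 2)⁻¹) ∂μ = ∫⁻ x, (‖Q - Y x‖ₑ ^ 2)⁻¹ ∂μ := by
    refine lintegral_congr_ae ?_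
    filter_upwards [hK.ae_ne hY hQ] with x hx
    have : 0 < ‖Q - Y x‖ := norm_pos_iff.2 hx
    rw [ENNReal.ofReal_inv_of_pos (by positivity), ENNReal.ofReal_pow this.le,
      ofReal_norm]
  have hle := hK Q hQ
  rw [← heq] at hle
  refine ⟨⟨hm.aestronglyMeasurable, ?_⟩, fun hK0 => ?_⟩
  · rw [hasFiniteIntegral_iff_ofReal (ae_of_all _ h0)]
    exact hle.trans_lt ENNReal.ofReal_lt_top
  · rw [integral_eq_lintegral_of_nonneg_ae (ae_of_all _ h0) hm.aestronglyMeasurable]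
    exact ENNReal.toReal_le_of_le_ofReal hK0 hle

lemma inv_le_one_add_inv_sq (r : ℝ) : r⁻¹ ≤ 1 + (r ^ 2)⁻¹ := by
  rw [← inv_pow]; nlinarith [sq_nonneg (r⁻¹ - 1)]

lemma InvSqMomentLE.integrable_inv [IsProbabilityMeasure μ] (hK : InvSqMomentLE μ Y C K)
    (hK0 : 0 ≤ K) (hY : StronglyMeasurable Y) {Q : E} (hQ : ‖Q‖ ≤ C) :
    Integrable (fun x => ‖Q - Y x‖⁻¹) μ ∧ ∫ x, ‖Q - Y x‖⁻¹ ∂μ ≤ 1 + K := by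
  obtain ⟨h1, h2⟩ := hK.integrable_inv_sq hY hQ
  have h3 : Integrable (fun x => 1 + (‖Q - Y x‖ ^ 2)⁻¹) μ := (integrable_const 1).add h1
  have hi : Integrable (fun x => ‖Q - Y x‖⁻¹) μ := by
    refine h3.mono' (stronglyMeasurable_sub hY Q).norm.measurable.inv.aestronglyMeasurable
      (ae_of_all _ fun x => ?_)
    rw [Real.norm_of_nonneg (by positivity)]
    exact inv_le_one_add_inv_sq _
  refine ⟨hi, ?_⟩
  calc _ ≤ ∫ x, (1 + (‖Q - Y x‖ ^ 2)⁻¹) ∂μ := integral_mono hi h3 fun x => inv_le_one_add_inv_sq _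
    _ = 1 + ∫ x, (‖Q - Y x‖ ^ 2)⁻¹ ∂μ := by rw [integral_add (integrable_const 1) h1]; simp
    _ ≤ 1 + K := by gcongr; exact h2 hK0

lemma InvSqMomentLE.measureReal_ball_le [IsProbabilityMeasure μ] (hK : InvSqMomentLE μ Y C K)
    (hK0 : 0 ≤ K) (hY : StronglyMeasurable Y) {Q : E} (hQ : ‖Q‖ ≤ C) {r : ℝ} (hr : 0 < r) :
    μ.real {x | ‖Q - Y x‖ < r} ≤ K * r ^ 2 := by
  obtain ⟨h1, h2⟩ := hK.integrable_inv_sq hY hQ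
  have h3 := mul_meas_ge_le_integral_of_nonneg (ae_of_all μ fun x => show
    0 ≤ (‖Q - Y x‖ ^ 2)⁻¹ by positivity) h1 (r ^ 2)⁻¹
  have h4 : μ.real {x | ‖Q - Y x‖ < r} ≤ μ.real {x | (r ^ 2)⁻¹ ≤ (‖Q - Y x‖ ^ 2)⁻¹} := by
    refine ENNReal.toReal_mono (measure_ne_top _ _) (measure_mono_ae ?_)
    filter_upwards [hK.ae_ne hY hQ] with x hx hlt
    have h0 : 0 < ‖Q - Y x‖ := norm_pos_iff.2 hx
    have hlt' : ‖Q - Y x‖ < r := hlt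
    change (r ^ 2)⁻¹ ≤ (‖Q - Y x‖ ^ 2)⁻¹
    gcongr
  have h5 := h3.trans (h2 hK0)
  rw [inv_mul_le_iff₀ (by positivity)] at h5
  linarith

/-- The mean sign vector `E sgn (Q - Y)`, the gradient of `Q ↦ E{‖Q - Y‖ - ‖Y‖}`. -/
def meanSgn (μ : Measure S) (Y : S → E) (Q : E) : E := ∫ x, sgn (Q - Y x) ∂μ

lemma integrable_sgn [IsFiniteMeasure μ] (hY : StronglyMeasurable Y) (Q : E) :
    Integrable (fun x => sgn (Q - Y x)) μ :=
  Integrable.of_bound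
    (stronglyMeasurable_sgn_comp (stronglyMeasurable_sub hY Q)).aestronglyMeasurable 1
    (ae_of_all _ fun _ => norm_sgn_le_one _)

lemma integrable_norm_sub_sub_norm [IsFiniteMeasure μ] (hY : StronglyMeasurable Y) (Q : E) :
    Integrable (fun x => ‖Q - Y x‖ - ‖Y x‖) μ := by
  refine Integrable.of_bound
    ((stronglyMeasurable_sub hY Q).norm.sub hY.norm).aestronglyMeasurable ‖Q‖
    (ae_of_all _ fun x => ?_)
  have := abs_norm_sub_norm_le (Q - Y x) (-Y x)
  rwa [norm_neg, sub_neg_eq_add, sub_add_cancel] at this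

lemma integral_norm_add_sub [IsFiniteMeasure μ] (hY : StronglyMeasurable Y) (Q h : E) :
    (∫ x, (‖Q + h - Y x‖ - ‖Y x‖) ∂μ) - ∫ x, (‖Q - Y x‖ - ‖Y x‖) ∂μ
      = ∫ x, (‖Q - Y x + h‖ - ‖Q - Y x‖) ∂μ := by
  rw [← integral_sub (integrable_norm_sub_sub_norm hY _) (integrable_norm_sub_sub_norm hY _)]
  congr 1 with x
  rw [sub_sub_sub_cancel_right, sub_add_eq_add_sub]

lemma integrable_norm_add_sub [IsFiniteMeasure μ] (hY : StronglyMeasurable Y) (Q h : E) :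
    Integrable (fun x => ‖Q - Y x + h‖ - ‖Q - Y x‖) μ := by
  refine ((integrable_norm_sub_sub_norm hY (Q + h)).sub (integrable_norm_sub_sub_norm hY Q)).congr
    (ae_of_all _ fun x => ?_)
  simp only [Pi.sub_apply]
  rw [sub_sub_sub_cancel_right, sub_add_eq_add_sub]

lemma inner_meanSgn [IsFiniteMeasure μ] [CompleteSpace E] (hY : StronglyMeasurable Y) (Q h : E) :
    inner ℝ (meanSgn μ Y Q) h = ∫ x, inner ℝ (sgn (Q - Y x)) h ∂μ := by
  rw [real_inner_comm, meanSgn, ← integral_inner (integrable_sgn hY Q)]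
  simp_rw [real_inner_comm]

/-- A minimizer of `Q ↦ E{‖Q - Y‖ - ‖Y‖} - ⟪w, Q⟫` is a zero of the gradient. -/
lemma InvSqMomentLE.meanSgn_eq_of_isMin [IsProbabilityMeasure μ] [CompleteSpace E]
    (hK : InvSqMomentLE μ Y C K) (hK0 : 0 ≤ K) (hY : StronglyMeasurable Y) {Q w : E}
    (hQ : ‖Q‖ ≤ C)
    (hmin : ∀ Q', (∫ x, (‖Q - Y x‖ - ‖Y x‖) ∂μ) - inner ℝ w Q
      ≤ (∫ x, (‖Q' - Y x‖ - ‖Y x‖) ∂μ) - inner ℝ w Q') : meanSgn μ Y Q = w := by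
  obtain ⟨hi, hile⟩ := hK.integrable_inv hK0 hY hQ
  have hstep : ∀ h : E, 0 ≤ inner ℝ (meanSgn μ Y Q - w) h + 2 * ‖h‖ ^ 2 * (1 + K) := by
    intro h
    have h1 := hmin (Q + h)
    have h2 := integral_norm_add_sub (μ := μ) hY Q h
    have h3 : ∫ x, (‖Q - Y x + h‖ - ‖Q - Y x‖) ∂μ
        ≤ ∫ x, (inner ℝ (sgn (Q - Y x)) h + 2 * ‖h‖ ^ 2 * ‖Q - Y x‖⁻¹) ∂μ := by
      refine integral_mono_ae (integrable_norm_add_sub hY Q h)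
        (((integrable_sgn hY Q).inner_const h).add (hi.const_mul _)) ?_
      filter_upwards [hK.ae_ne hY hQ] with x hx
      have := norm_add_le_inner_sgn hx h
      rw [div_eq_mul_inv] at this
      linarith
    rw [integral_add ((integrable_sgn hY Q).inner_const h) (hi.const_mul _), ← inner_meanSgn hY,
      integral_const_mul] at h3
    rw [inner_sub_left]
    rw [inner_add_right] at h1
    have h4 : 2 * ‖h‖ ^ 2 * ∫ x, ‖Q - Y x‖⁻¹ ∂μ ≤ 2 * ‖h‖ ^ 2 * (1 + K) := by gcongr
    linarith
  rw [← sub_eq_zero, ← norm_eq_zero]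
  set G := meanSgn μ Y Q - w
  have h1 := hstep (-(4 * (1 + K))⁻¹ • G)
  rw [inner_smul_right, real_inner_self_eq_norm_sq, norm_smul, norm_neg, norm_inv,
    Real.norm_of_nonneg (by positivity)] at h1
  have h2 : 2 * ((4 * (1 + K))⁻¹ * ‖G‖) ^ 2 * (1 + K) = 2⁻¹ * ((4 * (1 + K))⁻¹ * ‖G‖ ^ 2) := by
    field_simp; norm_num
  rw [h2] at h1
  have h3 : 0 < (4 * (1 + K))⁻¹ := by positivity
  have h4 : (4 * (1 + K))⁻¹ * ‖G‖ ^ 2 ≤ 0 := by linarith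
  have h5 : ‖G‖ ^ 2 ≤ 0 := by
    by_contra hc
    push Not at hc
    nlinarith [mul_pos h3 hc]
  nlinarith [norm_nonneg G]

end Moments

/-! ### The Hessian of the mean distance -/

section Hessian

variable {E : Type*} [NormedAddCommGroup E] [InnerProductSpace ℝ E] [FiniteDimensional ℝ E]
  {S : Type*} [MeasurableSpace S] {μ : Measure S} {Y : S → E} {C K : ℝ}

/-- The mean `E D(Q - Y)` of the derivatives of the sign map, the Hessian of
`Q ↦ E{‖Q - Y‖ - ‖Y‖}`. -/
def meanHessian (μ : Measure S) (Y : S → E) (Q : E) : E →L[ℝ] E := ∫ x, sgnDeriv (Q - Y x) ∂μ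

lemma stronglyMeasurable_sgnDeriv (hY : StronglyMeasurable Y) (Q : E) :
    StronglyMeasurable fun x => sgnDeriv (Q - Y x) := by
  have h := stronglyMeasurable_sub hY Q
  have h1 : Continuous fun a : E =>
      ContinuousLinearMap.id ℝ E - (innerSL ℝ a).smulRight a := by
    refine continuous_const.sub ?_
    exact ((ContinuousLinearMap.smulRightL ℝ E E).continuous.comp
      (innerSL ℝ).continuous).clm_apply continuous_id
  exact StronglyMeasurable.smul (h.norm.measurable.inv.stronglyMeasurable)
    (h1.comp_stronglyMeasurable (stronglyMeasurable_sgn_comp h))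

variable [IsProbabilityMeasure μ]

lemma InvSqMomentLE.integrable_sgnDeriv (hK : InvSqMomentLE μ Y C K) (hK0 : 0 ≤ K)
    (hY : StronglyMeasurable Y) {Q : E} (hQ : ‖Q‖ ≤ C) :
    Integrable (fun x => sgnDeriv (Q - Y x)) μ :=
  ((hK.integrable_inv hK0 hY hQ).1.const_mul 2).mono'
    (stronglyMeasurable_sgnDeriv hY Q).aestronglyMeasurable
    (ae_of_all _ fun _ => norm_sgnDeriv_le _)

lemma InvSqMomentLE.meanHessian_apply (hK : InvSqMomentLE μ Y C K) (hK0 : 0 ≤ K)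
    (hY : StronglyMeasurable Y) {Q : E} (hQ : ‖Q‖ ≤ C) (h : E) :
    meanHessian μ Y Q h = ∫ x, sgnDeriv (Q - Y x) h ∂μ :=
  ContinuousLinearMap.integral_apply (hK.integrable_sgnDeriv hK0 hY hQ) h

lemma InvSqMomentLE.inner_meanHessian (hK : InvSqMomentLE μ Y C K) (hK0 : 0 ≤ K)
    (hY : StronglyMeasurable Y) {Q : E} (hQ : ‖Q‖ ≤ C) (h v : E) :
    inner ℝ (meanHessian μ Y Q h) v = ∫ x, inner ℝ (sgnDeriv (Q - Y x) h) v ∂μ := by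
  rw [hK.meanHessian_apply hK0 hY hQ, real_inner_comm, ← integral_inner]
  · simp_rw [real_inner_comm]
  · exact (hK.integrable_sgnDeriv hK0 hY hQ).apply_continuousLinearMap h

lemma InvSqMomentLE.meanHessian_symm (hK : InvSqMomentLE μ Y C K) (hK0 : 0 ≤ K)
    (hY : StronglyMeasurable Y) {Q : E} (hQ : ‖Q‖ ≤ C) (h v : E) :
    inner ℝ (meanHessian μ Y Q h) v = inner ℝ (meanHessian μ Y Q v) h := by
  rw [hK.inner_meanHessian hK0 hY hQ, hK.inner_meanHessian hK0 hY hQ]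
  congr 1 with x
  rw [inner_sgnDeriv, inner_sgnDeriv, real_inner_comm]; ring

/-- The bound for an integral whose integrand is dominated by a multiple of `‖Q - Y‖⁻²`. -/
lemma InvSqMomentLE.norm_integral_le {F : Type*} [NormedAddCommGroup F] [NormedSpace ℝ F]
    (hK : InvSqMomentLE μ Y C K) (hK0 : 0 ≤ K)
    (hY : StronglyMeasurable Y) {Q : E} (hQ : ‖Q‖ ≤ C) {f : S → F} {c : ℝ} (hc : 0 ≤ c)
    (hf : ∀ x, Q - Y x ≠ 0 → ‖f x‖ ≤ c / ‖Q - Y x‖ ^ 2) : ‖∫ x, f x ∂μ‖ ≤ c * K := by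
  obtain ⟨h1, h2⟩ := hK.integrable_inv_sq hY hQ
  calc _ ≤ ∫ x, c * (‖Q - Y x‖ ^ 2)⁻¹ ∂μ := by
        refine norm_integral_le_of_norm_le (h1.const_mul c) ?_
        filter_upwards [hK.ae_ne hY hQ] with x hx
        exact hf x hx
    _ ≤ c * K := by rw [integral_const_mul]; gcongr; exact h2 hK0

lemma InvSqMomentLE.norm_meanSgn_add_sub_sub_le (hK : InvSqMomentLE μ Y C K) (hK0 : 0 ≤ K)
    (hY : StronglyMeasurable Y) {Q : E} (hQ : ‖Q‖ ≤ C) (h : E) :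
    ‖meanSgn μ Y (Q + h) - meanSgn μ Y Q - meanHessian μ Y Q h‖ ≤ 4 * ‖h‖ ^ 2 * K := by
  have i1 : Integrable (fun x => sgn (Q + h - Y x) - sgn (Q - Y x)) μ :=
    (integrable_sgn hY _).sub (integrable_sgn hY _)
  rw [hK.meanHessian_apply hK0 hY hQ, meanSgn, meanSgn,
    ← integral_sub (integrable_sgn hY _) (integrable_sgn hY _),
    ← integral_sub i1 ((hK.integrable_sgnDeriv hK0 hY hQ).apply_continuousLinearMap h)]
  refine hK.norm_integral_le hK0 hY hQ (by positivity) fun x hx => ?_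
  rw [← sub_add_eq_add_sub]
  exact norm_sgn_add_sub_sub_le hx h

lemma InvSqMomentLE.abs_integral_norm_sub_le (hK : InvSqMomentLE μ Y C K) (hK0 : 0 ≤ K)
    (hY : StronglyMeasurable Y) {Q : E} (hQ : ‖Q‖ ≤ C) (h : E) :
    |(∫ x, (‖Q + h - Y x‖ - ‖Y x‖) ∂μ) - (∫ x, (‖Q - Y x‖ - ‖Y x‖) ∂μ)
      - inner ℝ (meanSgn μ Y Q) h - 2⁻¹ * inner ℝ (meanHessian μ Y Q h) h|
      ≤ 8 * ‖h‖ ^ 3 * K := by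
  have i1 := integrable_norm_add_sub (μ := μ) hY Q h
  have i2 : Integrable (fun x => inner ℝ (sgn (Q - Y x)) h) μ :=
    (integrable_sgn hY Q).inner_const h
  have i3 : Integrable (fun x => inner ℝ (sgnDeriv (Q - Y x) h) h) μ :=
    ((hK.integrable_sgnDeriv hK0 hY hQ).apply_continuousLinearMap h).inner_const h
  rw [integral_norm_add_sub hY, inner_meanSgn hY, hK.inner_meanHessian hK0 hY hQ,
    ← integral_const_mul, ← integral_sub i1 i2, ← integral_sub (i1.sub' i2) (i3.const_mul _)]
  rw [← Real.norm_eq_abs]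
  exact hK.norm_integral_le hK0 hY hQ (c := 8 * ‖h‖ ^ 3) (by positivity)
    fun x hx => abs_norm_add_sub_le hx h

end Hessian

/-! ### Strong monotonicity of the mean sign vector -/

section Monotone

variable {E : Type*} [NormedAddCommGroup E] [InnerProductSpace ℝ E]
  {S : Type*} [MeasurableSpace S] {μ : Measure S} [IsProbabilityMeasure μ] {Y : S → E}
  {C K M ε : ℝ}

/-- A tube of radius `ε` around a line has mass of order `ε` inside a ball: it is covered by
`O(1 / ε)` balls of radius `2 ε`, each of mass at most `K (2 ε)²`. -/
lemma InvSqMomentLE.measureReal_tube_le (hK : InvSqMomentLE μ Y (2 * C + M + 1) K) (hK0 : 0 ≤ K)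
    (hY : StronglyMeasurable Y) (hM : 0 ≤ M) {Q e : E} (hQ : ‖Q‖ ≤ C)
    (he : ‖e‖ = 1) (hε : 0 < ε) (hε1 : ε ≤ 1) :
    μ.real {x | ‖Y x‖ ≤ M ∧ ‖Q - Y x‖ ^ 2 - inner ℝ (Q - Y x) e ^ 2 < ε ^ 2}
      ≤ 4 * K * ε * (2 * (M + C) + 3) := by
  have hC : 0 ≤ C := (norm_nonneg _).trans hQ
  set N : ℕ := ⌈(M + C) / ε⌉₊ with hN
  have hN1 : (M + C) / ε ≤ N := Nat.le_ceil _
  have hN2 : (N : ℝ) * ε ≤ M + C + ε := by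
    have := (Nat.ceil_lt_add_one (show 0 ≤ (M + C) / ε by positivity)).le
    rw [← hN] at this
    calc (N : ℝ) * ε ≤ ((M + C) / ε + 1) * ε := by gcongr
      _ = _ := by field_simp
  have hcover : {x | ‖Y x‖ ≤ M ∧ ‖Q - Y x‖ ^ 2 - inner ℝ (Q - Y x) e ^ 2 < ε ^ 2}
      ⊆ ⋃ j ∈ Finset.Icc (-(N : ℤ)) N, {x | ‖(Q - ((j : ℝ) * ε) • e) - Y x‖ < 2 * ε} := by
    rintro x ⟨hx1, hx2⟩
    set t : ℝ := inner ℝ (Q - Y x) e with ht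
    have htle : |t| ≤ M + C := by
      refine (abs_real_inner_le_norm _ _).trans ?_
      rw [he, mul_one]
      refine (norm_sub_le _ _).trans ?_
      linarith
    obtain ⟨ht1, ht2⟩ := abs_le.1 htle
    have hj1 := Int.floor_le (t / ε)
    have hj2 := Int.lt_floor_add_one (t / ε)
    have hup : t / ε ≤ N := le_trans (by gcongr) hN1
    have hlo : -(N : ℝ) ≤ t / ε := by
      have : -((M + C) / ε) ≤ t / ε := by rw [← neg_div]; gcongr
      linarith
    simp only [Set.mem_iUnion, Finset.mem_Icc, exists_prop]
    refine ⟨⌊t / ε⌋, ⟨Int.le_floor.2 (by push_cast; exact hlo), ?_⟩, ?_⟩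
    · have : ((⌊t / ε⌋ : ℤ) : ℝ) ≤ ((N : ℤ) : ℝ) := by push_cast; linarith
      exact_mod_cast this
    · change ‖_‖ < 2 * ε
      set s : ℝ := (⌊t / ε⌋ : ℝ) * ε with hs
      have hs1 : s ≤ t := by rw [hs]; rwa [le_div_iff₀ hε] at hj1
      have hs2 : t < s + ε := by
        rw [div_lt_iff₀ hε] at hj2; rw [hs]; linarith
      have hn : ‖Q - s • e - Y x‖ ^ 2 = (‖Q - Y x‖ ^ 2 - t ^ 2) + (t - s) ^ 2 := by
        rw [sub_right_comm, norm_sub_sq_real, inner_smul_right, norm_smul, he, mul_one,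
          Real.norm_eq_abs, sq_abs, ← ht]; ring
      refine lt_of_pow_lt_pow_left₀ 2 (by positivity) ?_
      rw [hn]; nlinarith
  have hball : ∀ j ∈ Finset.Icc (-(N : ℤ)) N,
      μ.real {x | ‖(Q - ((j : ℝ) * ε) • e) - Y x‖ < 2 * ε} ≤ K * (2 * ε) ^ 2 := by
    intro j hj
    rw [Finset.mem_Icc] at hj
    refine hK.measureReal_ball_le hK0 hY ?_ (by positivity)
    refine (norm_sub_le _ _).trans ?_
    rw [norm_smul, he, mul_one, norm_mul, Real.norm_of_nonneg hε.le, Real.norm_eq_abs]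
    have : |(j : ℝ)| ≤ N := by
      rw [abs_le]; exact ⟨by exact_mod_cast hj.1, by exact_mod_cast hj.2⟩
    nlinarith
  calc _ ≤ μ.real (⋃ j ∈ Finset.Icc (-(N : ℤ)) N,
        {x | ‖(Q - ((j : ℝ) * ε) • e) - Y x‖ < 2 * ε}) :=
          measureReal_mono hcover (measure_ne_top _ _)
    _ ≤ ∑ j ∈ Finset.Icc (-(N : ℤ)) N, μ.real {x | ‖(Q - ((j : ℝ) * ε) • e) - Y x‖ < 2 * ε} :=
        measureReal_biUnion_finset_le _ _
    _ ≤ ∑ j ∈ Finset.Icc (-(N : ℤ)) N, K * (2 * ε) ^ 2 := Finset.sum_le_sum hball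
    _ = (2 * N + 1) * (K * (2 * ε) ^ 2) := by
        rw [Finset.sum_const, Int.card_Icc, nsmul_eq_mul]
        congr 1
        have : ((N : ℤ) + 1 - -(N : ℤ)).toNat = 2 * N + 1 := by omega
        rw [this]; push_cast; ring
    _ = 4 * K * ε * (2 * (N * ε) + ε) := by ring
    _ ≤ _ := mul_le_mul_of_nonneg_left (by linarith) (by positivity)

/-- Strong monotonicity of the mean sign vector on balls. -/
lemma InvSqMomentLE.le_inner_meanSgn_sub [CompleteSpace E]
    (hK : InvSqMomentLE μ Y (2 * C + M + 1) K) (hK0 : 0 ≤ K)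
    (hY : StronglyMeasurable Y) (hM : 0 < M) (hmass : 1 / 2 ≤ μ.real {x | ‖Y x‖ ≤ M})
    (hε : 0 < ε) (hε1 : ε ≤ 1) (hεK : 4 * K * ε * (2 * (M + C) + 3) ≤ 1 / 4)
    {Q Q' : E} (hQ : ‖Q‖ ≤ C) (hQ' : ‖Q'‖ ≤ C) :
    ε ^ 2 / (4 * (M + C) ^ 3) * ‖Q' - Q‖ ^ 2
      ≤ inner ℝ (meanSgn μ Y Q' - meanSgn μ Y Q) (Q' - Q) := by
  rcases eq_or_ne Q' Q with rfl | hne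
  · simp
  have hC : 0 ≤ C := (norm_nonneg _).trans hQ
  set h := Q' - Q with hh
  have hh0 : 0 < ‖h‖ := norm_pos_iff.2 (sub_ne_zero.2 hne)
  set e := ‖h‖⁻¹ • h with he
  have he1 : ‖e‖ = 1 := by
    rw [he, norm_smul, norm_inv, norm_norm, inv_mul_cancel₀ hh0.ne']
  have htube := hK.measureReal_tube_le hK0 hY hM.le hQ he1 hε hε1
  set B : Set S := {x | ‖Y x‖ ≤ M ∧ ε ^ 2 ≤ ‖Q - Y x‖ ^ 2 - inner ℝ (Q - Y x) e ^ 2} with hBdef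
  have hYQ := stronglyMeasurable_sub hY Q
  have hB : MeasurableSet B :=
    (measurableSet_le hY.norm.measurable measurable_const).inter
      (measurableSet_le measurable_const ((hYQ.norm.measurable.pow_const 2).sub
        ((hYQ.inner stronglyMeasurable_const).measurable.pow_const 2)))
  have hBmass : 1 / 4 ≤ μ.real B := by
    have hsub : {x | ‖Y x‖ ≤ M}
        ⊆ B ∪ {x | ‖Y x‖ ≤ M ∧ ‖Q - Y x‖ ^ 2 - inner ℝ (Q - Y x) e ^ 2 < ε ^ 2} := by
      intro x hx
      rcases le_or_gt (ε ^ 2) (‖Q - Y x‖ ^ 2 - inner ℝ (Q - Y x) e ^ 2) with h1 | h1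
      · exact Or.inl ⟨hx, h1⟩
      · exact Or.inr ⟨hx, h1⟩
    have := (measureReal_mono (μ := μ) hsub).trans (measureReal_union_le _ _)
    linarith
  have hpt : ∀ x, B.indicator (fun _ => ε ^ 2 / (M + C) ^ 3 * ‖h‖ ^ 2) x
      ≤ inner ℝ (sgn (Q' - Y x) - sgn (Q - Y x)) h := by
    intro x
    have hsubeq : (Q' - Y x) - (Q - Y x) = h := by rw [sub_sub_sub_cancel_right]
    by_cases hx : x ∈ B
    · rw [Set.indicator_of_mem hx]
      have hle : ∀ R : E, ‖R‖ ≤ C → ‖R - Y x‖ ≤ M + C := fun R hR =>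
        (norm_sub_le _ _).trans (by linarith [hx.1])
      have hline := hx.2
      rw [he, inner_smul_right] at hline
      have h2 := le_inner_sgn_sub_sgn (hle Q hQ) (hle Q' hQ') hε (by
        rw [hsubeq]
        calc ε ^ 2 * ‖h‖ ^ 2
            ≤ (‖Q - Y x‖ ^ 2 - (‖h‖⁻¹ * inner ℝ (Q - Y x) h) ^ 2) * ‖h‖ ^ 2 := by gcongr
          _ = _ := by field_simp)
      rwa [hsubeq] at h2
    · rw [Set.indicator_of_notMem hx]
      have := inner_sgn_sub_sgn_nonneg (Q - Y x) (Q' - Y x)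
      rwa [hsubeq] at this
  have hint : Integrable (fun x => sgn (Q' - Y x) - sgn (Q - Y x)) μ :=
    (integrable_sgn hY _).sub (integrable_sgn hY _)
  have heq : inner ℝ (meanSgn μ Y Q' - meanSgn μ Y Q) h
      = ∫ x, inner ℝ (sgn (Q' - Y x) - sgn (Q - Y x)) h ∂μ := by
    rw [inner_sub_left, inner_meanSgn hY, inner_meanSgn hY, ← integral_sub
      ((integrable_sgn hY _).inner_const h) ((integrable_sgn hY _).inner_const h)]
    simp_rw [inner_sub_left]
  rw [heq]
  calc ε ^ 2 / (4 * (M + C) ^ 3) * ‖h‖ ^ 2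
      = 1 / 4 * (ε ^ 2 / (M + C) ^ 3 * ‖h‖ ^ 2) := by field_simp
    _ ≤ μ.real B * (ε ^ 2 / (M + C) ^ 3 * ‖h‖ ^ 2) := by gcongr
    _ = ∫ x, B.indicator (fun _ => ε ^ 2 / (M + C) ^ 3 * ‖h‖ ^ 2) x ∂μ := by
        rw [integral_indicator_const _ hB, smul_eq_mul]
    _ ≤ _ := integral_mono ((integrable_const _).indicator hB) (hint.inner_const h) hpt

end Monotone

/-! ### Existence of minimizers -/

section Existence

variable {E : Type*} [NormedAddCommGroup E] [InnerProductSpace ℝ E]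
  {S : Type*} [MeasurableSpace S] {μ : Measure S} [IsProbabilityMeasure μ] {Y : S → E}

lemma norm_sub_two_mul_le (Q y : E) : ‖Q‖ - 2 * ‖y‖ ≤ ‖Q - y‖ - ‖y‖ := by
  have := norm_sub_norm_le Q y
  linarith

/-- Coercivity of the mean distance, from a bound for the tail of `‖Y‖`. -/
lemma le_integral_norm_sub (hY : StronglyMeasurable Y) {M p : ℝ} (hM : 0 ≤ M)
    (hp : μ.real {x | M < ‖Y x‖} ≤ p) (Q : E) :
    (1 - 2 * p) * ‖Q‖ - 2 * M ≤ ∫ x, (‖Q - Y x‖ - ‖Y x‖) ∂μ := by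
  set B : Set S := {x | M < ‖Y x‖}
  have hB : MeasurableSet B := measurableSet_lt measurable_const hY.norm.measurable
  have hpt : ∀ x, ‖Q‖ - 2 * M - B.indicator (fun _ => 2 * ‖Q‖) x ≤ ‖Q - Y x‖ - ‖Y x‖ := by
    intro x
    by_cases hx : x ∈ B
    · rw [Set.indicator_of_mem hx]
      have := norm_sub_norm_le (Y x) Q
      rw [norm_sub_rev] at this
      linarith
    · rw [Set.indicator_of_notMem hx]
      have h1 := norm_sub_two_mul_le Q (Y x)
      have h2 : ‖Y x‖ ≤ M := not_lt.1 hx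
      linarith
  have hi : Integrable (fun x => B.indicator (fun _ => 2 * ‖Q‖) x) μ :=
    (integrable_const _).indicator hB
  have h1 := integral_mono ((integrable_const (‖Q‖ - 2 * M)).sub hi)
    (integrable_norm_sub_sub_norm (μ := μ) hY Q) hpt
  simp only [Pi.sub_apply] at h1
  rw [integral_sub (integrable_const _) hi, integral_indicator_const _ hB] at h1
  simp only [integral_const, probReal_univ, smul_eq_mul, one_mul] at h1
  nlinarith [norm_nonneg Q]

lemma exists_forall_le_of_coercive [FiniteDimensional ℝ E] {f : E → ℝ} (hf : Continuous f)
    {c D : ℝ} (hc : 0 < c) (hfc : ∀ Q, c * ‖Q‖ - D ≤ f Q) : ∃ Q, ∀ Q', f Q ≤ f Q' := by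
  have : ProperSpace E := FiniteDimensional.proper_real E
  refine hf.exists_forall_le (tendsto_atTop_mono hfc ?_)
  exact tendsto_atTop_add_const_right _ _
    ((tendsto_norm_cocompact_atTop (E := E)).const_mul_atTop hc)

lemma continuous_integral_norm_sub (hY : StronglyMeasurable Y) :
    Continuous fun Q : E => ∫ x, (‖Q - Y x‖ - ‖Y x‖) ∂μ := by
  refine LipschitzWith.continuous (K := 1) (LipschitzWith.of_dist_le_mul fun Q Q' => ?_)
  rw [NNReal.coe_one, one_mul, dist_eq_norm, dist_eq_norm, ← integral_sub
    (integrable_norm_sub_sub_norm hY _) (integrable_norm_sub_sub_norm hY _)]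
  refine (norm_integral_le_of_norm_le_const (C := ‖Q - Q'‖) (ae_of_all _ fun x => ?_)).trans
    (by simp)
  rw [sub_sub_sub_cancel_right]
  have := abs_norm_sub_norm_le (Q - Y x) (Q' - Y x)
  rwa [sub_sub_sub_cancel_right] at this

end Existence

/-! ### Nets of the unit ball -/

section Net

variable {E : Type*} [NormedAddCommGroup E] [InnerProductSpace ℝ E]

/-- The unit ball of a space of dimension at most `m` has a `k⁻¹`-net of at most
`(2 m k + 1) ^ m` points, formed from the points of a cubic grid. -/
lemma exists_finset_net [FiniteDimensional ℝ E] {m k : ℕ} (hm : 1 ≤ m)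
    (hE : Module.finrank ℝ E ≤ m) (hk : 1 ≤ k) :
    ∃ T : Finset E, (∀ v ∈ T, ‖v‖ ≤ 2) ∧ (∀ v : E, ‖v‖ ≤ 1 → ∃ w ∈ T, ‖v - w‖ ≤ (k : ℝ)⁻¹) ∧
      T.card ≤ (2 * (m * k) + 1) ^ m := by
  classical
  set r := Module.finrank ℝ E with hr
  set b := stdOrthonormalBasis ℝ E
  set s : ℕ := m * k with hs
  have hs0 : (0 : ℝ) < s := by
    have : 0 < s := Nat.mul_pos hm hk
    exact_mod_cast this
  set grid : (Fin r → ℤ) → E := fun j => ∑ i, ((j i : ℝ) / s) • b i with hgrid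
  set J : Finset (Fin r → ℤ) := Fintype.piFinset fun _ => Finset.Icc (-(s : ℤ)) s with hJ
  refine ⟨(J.image grid).filter fun v => ‖v‖ ≤ 2, fun v hv => (Finset.mem_filter.1 hv).2,
    fun v hv => ?_, ?_⟩
  · set j : Fin r → ℤ := fun i => ⌊b.repr v i * s⌋ with hj
    have hclose : ‖v - grid j‖ ≤ (k : ℝ)⁻¹ := by
      have h1 : v - grid j = ∑ i, (b.repr v i - (j i : ℝ) / s) • b i := by
        conv_lhs => rw [← b.sum_repr v]
        rw [hgrid, ← Finset.sum_sub_distrib]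
        simp_rw [sub_smul]
      rw [h1]
      calc _ ≤ ∑ i : Fin r, ‖(b.repr v i - (j i : ℝ) / s) • b i‖ := norm_sum_le _ _
        _ ≤ ∑ _i : Fin r, (s : ℝ)⁻¹ := by
            refine Finset.sum_le_sum fun i _ => ?_
            rw [norm_smul, b.norm_eq_one, mul_one, Real.norm_eq_abs]
            have e1 := Int.floor_le (b.repr v i * s)
            have e2 := Int.lt_floor_add_one (b.repr v i * s)
            have e3 : b.repr v i - (j i : ℝ) / s = (b.repr v i * s - j i) * (s : ℝ)⁻¹ := by
              field_simp
            rw [e3, abs_mul, abs_of_pos (inv_pos.2 hs0)]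
            refine mul_le_of_le_one_left (by positivity) ?_
            rw [abs_le]; constructor <;> simp only [hj] <;> linarith
        _ = r * (s : ℝ)⁻¹ := by simp
        _ ≤ m * (s : ℝ)⁻¹ := by gcongr
        _ = (k : ℝ)⁻¹ := by
            have : (0 : ℝ) < m := by exact_mod_cast hm
            have : (0 : ℝ) < k := by exact_mod_cast hk
            rw [hs]; push_cast; field_simp
    refine ⟨grid j, Finset.mem_filter.2 ⟨Finset.mem_image_of_mem _ ?_, ?_⟩, hclose⟩
    · rw [hJ, Fintype.mem_piFinset]
      intro i
      have hc : |b.repr v i| ≤ 1 := by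
        rw [b.repr_apply_apply]
        refine (abs_real_inner_le_norm _ _).trans ?_
        rwa [b.norm_eq_one, one_mul]
      obtain ⟨hc1, hc2⟩ := abs_le.1 hc
      rw [Finset.mem_Icc]
      refine ⟨Int.le_floor.2 ?_, ?_⟩
      · push_cast; nlinarith
      · have e1 := Int.floor_le (b.repr v i * s)
        have : ((j i : ℤ) : ℝ) ≤ ((s : ℤ) : ℝ) := by
          push_cast; simp only [hj]; nlinarith
        exact_mod_cast this
    · have h1 : ‖grid j‖ ≤ ‖v‖ + ‖v - grid j‖ := by
        have := norm_sub_le v (v - grid j)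
        rwa [sub_sub_cancel] at this
      have h2 : (k : ℝ)⁻¹ ≤ 1 := inv_le_one_of_one_le₀ (by exact_mod_cast hk)
      linarith
  · calc _ ≤ (J.image grid).card := Finset.card_filter_le _ _
      _ ≤ J.card := Finset.card_image_le
      _ = (2 * s + 1) ^ r := by
          rw [hJ, Fintype.card_piFinset]
          simp only [Int.card_Icc, Finset.prod_const, Finset.card_univ, Fintype.card_fin]
          congr 1; omega
      _ ≤ (2 * s + 1) ^ m := Nat.pow_le_pow_right (by omega) hE

end Net

/-! ### A Bernstein inequality for empirical means -/

section Concentration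

variable {S Ω : Type*} [MeasurableSpace S] [MeasurableSpace Ω] {P : Measure Ω}
  [IsProbabilityMeasure P] {μ : Measure S} [IsProbabilityMeasure μ] {X : ℕ → Ω → S}

/-- An exponential inequality of Bernstein type for the deviation of an empirical mean. -/
lemma measureReal_empirical_ge_le (hX : ∀ i, HasLaw (X i) μ P) (hindep : iIndepFun X P)
    {f : S → ℝ} (hf : Measurable f) {B σ2 l : ℝ} (hB : ∀ x, |f x| ≤ B)
    (hσ : ∫ x, f x ^ 2 ∂μ ≤ σ2) (hl : 0 ≤ l) (hlB : l * B ≤ 1 / 2) {n : ℕ} (hn : 1 ≤ n) (t : ℝ) :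
    P.real {ω | t ≤ (n : ℝ)⁻¹ * ∑ i ∈ Finset.range n, f (X i ω) - ∫ x, f x ∂μ}
      ≤ Real.exp (-(n * (l * t - l ^ 2 * σ2))) := by
  set m := ∫ x, f x ∂μ with hm
  have hfi : Integrable f μ := Integrable.of_bound hf.aestronglyMeasurable B (ae_of_all _ hB)
  have hf2 : Integrable (fun x => f x ^ 2) μ :=
    Integrable.of_bound (hf.pow_const 2).aestronglyMeasurable (B ^ 2) (ae_of_all _ fun x => by
      rw [norm_pow]; exact pow_le_pow_left₀ (norm_nonneg _) (hB x) 2)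
  have hmB : |m| ≤ B := by
    have := norm_integral_le_of_norm_le_const (μ := μ) (f := f) (ae_of_all _ hB)
    simpa using this
  set g : S → ℝ := fun x => f x - m with hg
  have hgm : Measurable g := hf.sub_const m
  have hgB : ∀ x, |l * g x| ≤ 1 := fun x => by
    rw [abs_mul, abs_of_nonneg hl]
    have : |g x| ≤ 2 * B := (abs_sub _ _).trans (by linarith [hB x])
    nlinarith
  have hgi : Integrable g μ := hfi.sub (integrable_const m)
  have hg0 : ∫ x, g x ∂μ = 0 := by
    rw [hg, integral_sub hfi (integrable_const m)]; simp [hm]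
  have hg2e : (fun x => g x ^ 2) = fun x => f x ^ 2 - 2 * m * f x + m ^ 2 := by
    ext x; simp only [hg]; ring
  have hg2i : Integrable (fun x => g x ^ 2) μ := by
    rw [hg2e]; exact (hf2.sub (hfi.const_mul _)).add (integrable_const _)
  have hg2 : ∫ x, g x ^ 2 ∂μ ≤ σ2 := by
    rw [hg2e, integral_add (hf2.sub' (hfi.const_mul _)) (integrable_const _),
      integral_sub hf2 (hfi.const_mul _), integral_const_mul, ← hm]
    simp only [integral_const, probReal_univ, one_smul]
    nlinarith [sq_nonneg m]
  have hexpi : Integrable (fun x => Real.exp (l * g x)) μ :=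
    Integrable.of_bound (hgm.const_mul l).exp.aestronglyMeasurable (Real.exp 1)
      (ae_of_all _ fun x => by
        rw [Real.norm_of_nonneg (Real.exp_pos _).le]
        exact Real.exp_le_exp.2 ((le_abs_self _).trans (hgB x)))
  have hgli : Integrable (fun x => 1 + l * g x) μ := (integrable_const 1).add (hgi.const_mul l)
  have hexp : ∫ x, Real.exp (l * g x) ∂μ ≤ Real.exp (l ^ 2 * σ2) := by
    -- `exp y ≤ 1 + y + y²` for `|y| ≤ 1`
    have h1 : ∫ x, Real.exp (l * g x) ∂μ ≤ ∫ x, (1 + l * g x + l ^ 2 * g x ^ 2) ∂μ := by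
      refine integral_mono hexpi
        (hgli.add (hg2i.const_mul _)) fun x => ?_
      have := (abs_le.1 (Real.abs_exp_sub_one_sub_id_le (hgB x))).2
      simp only
      nlinarith
    rw [integral_add hgli (hg2i.const_mul _),
      integral_add (integrable_const 1) (hgi.const_mul l), integral_const_mul,
      integral_const_mul, hg0] at h1
    simp only [integral_const, probReal_univ, one_smul, mul_zero, add_zero] at h1
    have h2 := Real.add_one_le_exp (l ^ 2 * σ2)
    have h3 : l ^ 2 * ∫ x, g x ^ 2 ∂μ ≤ l ^ 2 * σ2 := by gcongr
    linarith
  have hlaw : ∀ i, mgf (fun ω => g (X i ω)) P l = ∫ x, Real.exp (l * g x) ∂μ := fun i =>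
    (hX i).integral_comp (f := fun x => Real.exp (l * g x))
      (hgm.const_mul l).exp.aestronglyMeasurable
  have hind : iIndepFun (fun i ω => g (X i ω)) P := hindep.comp (fun _ => g) fun _ => hgm
  have haem : ∀ i, AEMeasurable (fun ω => g (X i ω)) P := fun i =>
    hgm.comp_aemeasurable (hX i).aemeasurable
  have hmgf := hind.mgf_sum₀ (t := l) haem (Finset.range n)
  have hsumabs : ∀ ω, l * (∑ i ∈ Finset.range n, fun ω => g (X i ω)) ω ≤ n := fun ω => by
    rw [Finset.sum_apply, Finset.mul_sum]
    calc _ ≤ ∑ i ∈ Finset.range n, (1 : ℝ) :=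
          Finset.sum_le_sum fun i _ => (le_abs_self _).trans (hgB _)
      _ = n := by simp
  have hcher := measure_ge_le_exp_mul_mgf (μ := P) (X := ∑ i ∈ Finset.range n, fun ω => g (X i ω))
    (n * t) hl (Integrable.of_bound
      (((Finset.aemeasurable_sum _ fun i _ => haem i).const_mul l).exp.aestronglyMeasurable)
      (Real.exp n) (ae_of_all _ fun ω => by
        rw [Real.norm_of_nonneg (Real.exp_pos _).le]
        exact Real.exp_le_exp.2 (hsumabs ω)))
  have hn0 : (0 : ℝ) < n := by exact_mod_cast hn
  have hset : {ω | t ≤ (n : ℝ)⁻¹ * ∑ i ∈ Finset.range n, f (X i ω) - m}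
      = {ω | n * t ≤ (∑ i ∈ Finset.range n, fun ω => g (X i ω)) ω} := by
    ext ω
    simp only [Set.mem_ofPred_eq, Finset.sum_apply, hg, Finset.sum_sub_distrib, Finset.sum_const,
      Finset.card_range, nsmul_eq_mul]
    rw [← mul_le_mul_iff_right₀ hn0, mul_sub, mul_inv_cancel_left₀ hn0.ne']
  rw [hset]
  refine hcher.trans ?_
  rw [hmgf]
  simp_rw [hlaw]
  rw [Finset.prod_const, Finset.card_range]
  calc _ ≤ Real.exp (-l * (n * t)) * Real.exp (l ^ 2 * σ2) ^ n := by
        gcongr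
    _ = _ := by
        rw [← Real.exp_nat_mul, ← Real.exp_add]; ring_nf

end Concentration

/-! ### Minimizers of the sample objective function -/

section SampleMinimizer

variable {E : Type*} [NormedAddCommGroup E] [InnerProductSpace ℝ E]

/-- The empirical counterpart `n⁻¹ ∑_{i < n} sgn (Q - y i)` of the mean sign vector. -/
def empSgn (n : ℕ) (y : ℕ → E) (Q : E) : E :=
  (n : ℝ)⁻¹ • ∑ i ∈ Finset.range n, sgn (Q - y i)

/-- The objective function of the sample `y 0, …, y (n - 1)` in the direction `w`. -/
def empObjective (n : ℕ) (y : ℕ → E) (w Q : E) : ℝ :=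
  (n : ℝ)⁻¹ * (∑ i ∈ Finset.range n, (‖Q - y i‖ - ‖y i‖)) - inner ℝ w Q

lemma inner_empSgn (n : ℕ) (y : ℕ → E) (Q h : E) :
    inner ℝ (empSgn n y Q) h = (n : ℝ)⁻¹ * ∑ i ∈ Finset.range n, inner ℝ (sgn (Q - y i)) h := by
  rw [empSgn, real_inner_smul_left, sum_inner]

lemma empObjective_add_sub (n : ℕ) (y : ℕ → E) (w Q h : E) :
    empObjective n y w (Q + h) - empObjective n y w Q
      = (n : ℝ)⁻¹ * (∑ i ∈ Finset.range n, (‖Q - y i + h‖ - ‖Q - y i‖)) - inner ℝ w h := by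
  have h1 : ∀ i, ‖Q - y i + h‖ - ‖Q - y i‖ = (‖Q + h - y i‖ - ‖y i‖) - (‖Q - y i‖ - ‖y i‖) := by
    intro i; rw [sub_sub_sub_cancel_right, sub_add_eq_add_sub]
  simp_rw [h1]
  rw [Finset.sum_sub_distrib, empObjective, empObjective, inner_add_right]
  ring

/-- The sample objective function has a minimizer: it is coercive. -/
lemma exists_forall_empObjective_le [FiniteDimensional ℝ E] {n : ℕ} (hn : 1 ≤ n) (y : ℕ → E)
    {w : E} (hw : ‖w‖ < 1) : ∃ Q, ∀ Q', empObjective n y w Q ≤ empObjective n y w Q' := by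
  have hn0 : (0 : ℝ) < n := by exact_mod_cast hn
  refine exists_forall_le_of_coercive (c := 1 - ‖w‖)
    (D := (n : ℝ)⁻¹ * ∑ i ∈ Finset.range n, 2 * ‖y i‖) ?_ (by linarith) fun Q => ?_
  · unfold empObjective; fun_prop
  · have h1 : ∑ i ∈ Finset.range n, (‖Q‖ - 2 * ‖y i‖)
        ≤ ∑ i ∈ Finset.range n, (‖Q - y i‖ - ‖y i‖) :=
      Finset.sum_le_sum fun i _ => norm_sub_two_mul_le Q (y i)
    rw [Finset.sum_sub_distrib, Finset.sum_const, Finset.card_range, nsmul_eq_mul] at h1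
    have h2 := mul_le_mul_of_nonneg_left h1 (inv_nonneg.2 hn0.le)
    rw [mul_sub, inv_mul_cancel_left₀ hn0.ne'] at h2
    have h3 := real_inner_le_norm w Q
    rw [empObjective]
    linarith

/-- The subgradient inequality at `Q`, tested against a minimizer. -/
lemma inner_empSgn_sub_nonpos {n : ℕ} {y : ℕ → E} {w Qhat : E}
    (hmin : ∀ Q', empObjective n y w Qhat ≤ empObjective n y w Q') (Q : E) :
    inner ℝ (empSgn n y Q - w) (Qhat - Q) ≤ 0 := by
  have h1 := hmin Q
  have h2 := empObjective_add_sub n y w Q (Qhat - Q)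
  rw [add_sub_cancel] at h2
  have h3 : ∑ i ∈ Finset.range n, inner ℝ (sgn (Q - y i)) (Qhat - Q)
      ≤ ∑ i ∈ Finset.range n, (‖Q - y i + (Qhat - Q)‖ - ‖Q - y i‖) :=
    Finset.sum_le_sum fun i _ => by linarith [norm_add_inner_sgn_le (Q - y i) (Qhat - Q)]
  have h4 := mul_le_mul_of_nonneg_left h3 (show 0 ≤ (n : ℝ)⁻¹ by positivity)
  rw [inner_sub_left, inner_empSgn]
  linarith

open scoped Classical in
/-- At a minimizer of the sample objective function the empirical gradient is bounded by the
proportion of the observations that coincide with the minimizer: the other observations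
contribute differentiable terms. -/
lemma norm_empSgn_sub_le {n : ℕ} {y : ℕ → E} {w Qhat : E}
    (hmin : ∀ Q', empObjective n y w Qhat ≤ empObjective n y w Q') :
    ‖empSgn n y Qhat - w‖
      ≤ (n : ℝ)⁻¹ * ∑ i ∈ Finset.range n, if Qhat - y i = 0 then (1 : ℝ) else 0 := by
  -- the first order condition is tested along the direction `-G`
  set e : ℝ := (n : ℝ)⁻¹ * ∑ i ∈ Finset.range n, if Qhat - y i = 0 then (1 : ℝ) else 0 with he
  set G := empSgn n y Qhat - w with hG
  set A : ℝ := (n : ℝ)⁻¹ * ∑ i ∈ Finset.range n, 2 * ‖G‖ ^ 2 / ‖Qhat - y i‖ with hA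
  have hstep : ∀ t : ℝ, 0 < t → 0 ≤ -‖G‖ ^ 2 + e * ‖G‖ + A * t := by
    intro t ht
    have hn : ‖-(t • G)‖ = t * ‖G‖ := by rw [norm_neg, norm_smul, Real.norm_of_nonneg ht.le]
    have h1 := hmin (Qhat + -(t • G))
    have h2 := empObjective_add_sub n y w Qhat (-(t • G))
    have h3 : ∑ i ∈ Finset.range n, (‖Qhat - y i + -(t • G)‖ - ‖Qhat - y i‖)
        ≤ ∑ i ∈ Finset.range n, (inner ℝ (sgn (Qhat - y i)) (-(t • G))
          + (if Qhat - y i = 0 then (1 : ℝ) else 0) * (t * ‖G‖)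
          + t ^ 2 * (2 * ‖G‖ ^ 2 / ‖Qhat - y i‖)) := by
      refine Finset.sum_le_sum fun i _ => ?_
      by_cases h0 : Qhat - y i = 0
      · rw [h0, sgn_zero, zero_add, hn]; simp
      · have := norm_add_le_inner_sgn h0 (-(t • G))
        rw [hn] at this
        rw [if_neg h0, zero_mul, add_zero]
        have h5 : 2 * (t * ‖G‖) ^ 2 / ‖Qhat - y i‖ = t ^ 2 * (2 * ‖G‖ ^ 2 / ‖Qhat - y i‖) := by
          ring
        linarith
    rw [Finset.sum_add_distrib, Finset.sum_add_distrib, ← Finset.sum_mul, ← Finset.mul_sum] at h3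
    have h4 := mul_le_mul_of_nonneg_left h3 (show 0 ≤ (n : ℝ)⁻¹ by positivity)
    rw [mul_add, mul_add, ← inner_empSgn, ← mul_assoc, ← he, mul_left_comm _ (t ^ 2), ← hA] at h4
    have h6 : inner ℝ (empSgn n y Qhat) (-(t • G)) - inner ℝ w (-(t • G)) = -(t * ‖G‖ ^ 2) := by
      rw [← inner_sub_left, ← hG, inner_neg_right, inner_smul_right, real_inner_self_eq_norm_sq]
    have h7 : 0 ≤ t * (-‖G‖ ^ 2 + e * ‖G‖ + A * t) := by nlinarith
    exact nonneg_of_mul_nonneg_right h7 ht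
  -- the term of second order disappears as `t → 0`
  have hlim : Tendsto (fun t : ℝ => -‖G‖ ^ 2 + e * ‖G‖ + A * t) (𝓝[>] 0)
      (𝓝 (-‖G‖ ^ 2 + e * ‖G‖ + A * 0)) :=
    Tendsto.mono_left (Continuous.tendsto (by fun_prop) _) nhdsWithin_le_nhds
  have h0 : 0 ≤ -‖G‖ ^ 2 + e * ‖G‖ + A * 0 :=
    ge_of_tendsto hlim (eventually_nhdsWithin_of_forall fun t ht => hstep t ht)
  have he0 : 0 ≤ e := by
    refine mul_nonneg (by positivity) (Finset.sum_nonneg fun i _ => ?_)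
    split_ifs <;> norm_num
  rcases (norm_nonneg G).eq_or_lt with h | h
  · rw [← h]; exact he0
  · nlinarith

/-- The envelope `min (1, η / ‖a‖)`, with the value `1` at `a = 0`, of half the oscillation of
the sign map over the ball of radius `η` around `a`. -/
def sgnOsc (η : ℝ) (a : E) : ℝ := η / max η ‖a‖

lemma sgnOsc_nonneg {η : ℝ} (hη : 0 < η) (a : E) : 0 ≤ sgnOsc η a :=
  div_nonneg hη.le (hη.le.trans (le_max_left _ _))

lemma sgnOsc_le_one {η : ℝ} (hη : 0 < η) (a : E) : sgnOsc η a ≤ 1 :=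
  (div_le_one (hη.trans_le (le_max_left _ _))).2 (le_max_left _ _)

lemma sgnOsc_le_div {η : ℝ} (hη : 0 < η) {a : E} (ha : a ≠ 0) : sgnOsc η a ≤ η / ‖a‖ := by
  have := norm_pos_iff.2 ha
  unfold sgnOsc
  gcongr
  exact le_max_right _ _

lemma sgnOsc_eq_one {η : ℝ} (hη : 0 < η) {a : E} (ha : ‖a‖ ≤ η) : sgnOsc η a = 1 := by
  rw [sgnOsc, max_eq_left ha, div_self hη.ne']

lemma norm_sgn_sub_sgn_le_sgnOsc {η : ℝ} (hη : 0 < η) {a b : E} (hab : ‖b - a‖ ≤ η) :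
    ‖sgn b - sgn a‖ ≤ 2 * sgnOsc η a := by
  rcases le_total ‖a‖ η with h | h
  · rw [sgnOsc_eq_one hη h]
    refine (norm_sub_le _ _).trans ?_
    linarith [norm_sgn_le_one a, norm_sgn_le_one b]
  · have ha : a ≠ 0 := norm_pos_iff.1 (hη.trans_le h)
    refine (norm_sgn_sub_sgn_le ha b).trans ?_
    rw [sgnOsc, max_eq_right h, mul_div_assoc]
    gcongr

/-- The norm of a vector is controlled by its inner products with a `1/2`-net of the ball. -/
lemma norm_le_of_forall_net {T : Set E}
    (hT : ∀ v : E, ‖v‖ ≤ 1 → ∃ w ∈ T, ‖v - w‖ ≤ 1 / 2) {F : E} {s : ℝ}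
    (hF : ∀ v ∈ T, inner ℝ F v ≤ s) : ‖F‖ ≤ 2 * s := by
  obtain ⟨w, hw, hvw⟩ := hT (sgn F) (norm_sgn_le_one F)
  have h1 := hF w hw
  have h2 : inner ℝ F (sgn F - w) ≤ ‖F‖ * (1 / 2) :=
    (real_inner_le_norm _ _).trans (by gcongr)
  rw [inner_sub_right, real_inner_comm, inner_sgn_self] at h2
  linarith

end SampleMinimizer

/-! ### Linearization at a sample quantile -/

section Linearization

variable {E : Type*} [NormedAddCommGroup E] [InnerProductSpace ℝ E] [FiniteDimensional ℝ E]
  {S : Type*} [MeasurableSpace S] {μ : Measure S} [IsProbabilityMeasure μ] {Y : S → E}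

/-- The empirical averages of the sign maps are close to their means along the net `Q₀ + ρ T` of
the ball of radius `ρ` around `Q₀`, tested in the directions of `T`, and so is the
empirical average of the oscillation of the sign map at the scale `η`. -/
structure NetClose (μ : Measure S) (Y : S → E) (n : ℕ) (x : ℕ → S) (T : Finset E) (Q₀ : E)
    (ρ η t₀ t₁ : ℝ) : Prop where
  increment : ∀ a ∈ T, ∀ v ∈ T,
    (n : ℝ)⁻¹ * ∑ i ∈ Finset.range n,
        inner ℝ (sgn (Q₀ + ρ • a - Y (x i)) - sgn (Q₀ - Y (x i))) v
      - ∫ s, inner ℝ (sgn (Q₀ + ρ • a - Y s) - sgn (Q₀ - Y s)) v ∂μ < t₁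
  center : ∀ v ∈ T,
    (n : ℝ)⁻¹ * ∑ i ∈ Finset.range n, inner ℝ (sgn (Q₀ - Y (x i))) v
      - ∫ s, inner ℝ (sgn (Q₀ - Y s)) v ∂μ < t₀
  oscillation : ∀ a ∈ T,
    (n : ℝ)⁻¹ * ∑ i ∈ Finset.range n, sgnOsc η (Q₀ + ρ • a - Y (x i))
      - ∫ s, sgnOsc η (Q₀ + ρ • a - Y s) ∂μ < t₁

lemma measurable_sgnOsc (hY : StronglyMeasurable Y) (η : ℝ) (Q : E) :
    Measurable fun s => sgnOsc η (Q - Y s) :=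
  measurable_const.div (measurable_const.max (stronglyMeasurable_sub hY Q).norm.measurable)

lemma integrable_sgnOsc (hY : StronglyMeasurable Y) {η : ℝ} (hη : 0 < η) (Q : E) :
    Integrable (fun s => sgnOsc η (Q - Y s)) μ :=
  Integrable.of_bound (measurable_sgnOsc hY η Q).aestronglyMeasurable 1
    (ae_of_all _ fun s => by
      rw [Real.norm_of_nonneg (sgnOsc_nonneg hη _)]; exact sgnOsc_le_one hη _)

lemma norm_meanSgn_sub_le (hY : StronglyMeasurable Y) {η : ℝ} (hη : 0 < η) {Q Q' : E}
    (h : ‖Q' - Q‖ ≤ η) :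
    ‖meanSgn μ Y Q' - meanSgn μ Y Q‖ ≤ 2 * ∫ s, sgnOsc η (Q - Y s) ∂μ := by
  rw [meanSgn, meanSgn, ← integral_sub (integrable_sgn hY _) (integrable_sgn hY _),
    ← integral_const_mul]
  refine norm_integral_le_of_norm_le ((integrable_sgnOsc hY hη Q).const_mul 2)
    (ae_of_all _ fun s => norm_sgn_sub_sgn_le_sgnOsc hη ?_)
  rwa [sub_sub_sub_cancel_right]

lemma norm_empSgn_sub_empSgn_le {n : ℕ} {y : ℕ → E} {η : ℝ} (hη : 0 < η) {Q Q' : E}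
    (h : ‖Q' - Q‖ ≤ η) : ‖empSgn n y Q' - empSgn n y Q‖
      ≤ 2 * ((n : ℝ)⁻¹ * ∑ i ∈ Finset.range n, sgnOsc η (Q - y i)) := by
  rw [empSgn, empSgn, ← smul_sub, ← Finset.sum_sub_distrib, norm_smul,
    Real.norm_of_nonneg (by positivity), mul_left_comm, Finset.mul_sum]
  gcongr
  refine norm_sum_le_of_le _ fun i _ => norm_sgn_sub_sgn_le_sgnOsc hη ?_
  rwa [sub_sub_sub_cancel_right]

variable {n k : ℕ} {x : ℕ → S} {T : Finset E} {Q₀ : E} {ρ η t₀ t₁ p : ℝ}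

lemma exists_mem_net (hT : ∀ v : E, ‖v‖ ≤ 1 → ∃ w ∈ T, ‖v - w‖ ≤ (k : ℝ)⁻¹) (hρ : 0 < ρ) {Q : E}
    (hQ : ‖Q - Q₀‖ ≤ ρ) : ∃ a ∈ T, ‖Q - (Q₀ + ρ • a)‖ ≤ ρ / k := by
  obtain ⟨a, ha, hle⟩ := hT (ρ⁻¹ • (Q - Q₀)) (by
    rw [norm_smul, norm_inv, Real.norm_of_nonneg hρ.le, inv_mul_le_iff₀ hρ]; linarith)
  refine ⟨a, ha, ?_⟩
  have : Q - (Q₀ + ρ • a) = ρ • (ρ⁻¹ • (Q - Q₀) - a) := by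
    rw [smul_sub, smul_inv_smul₀ hρ.ne']; abel
  rw [this, norm_smul, Real.norm_of_nonneg hρ.le, div_eq_mul_inv]
  gcongr

lemma NetClose.norm_center_le (h : NetClose μ Y n x T Q₀ ρ η t₀ t₁) (hY : StronglyMeasurable Y)
    (hT : ∀ v : E, ‖v‖ ≤ 1 → ∃ w ∈ T, ‖v - w‖ ≤ (k : ℝ)⁻¹) (hk : 2 ≤ k) :
    ‖empSgn n (fun i => Y (x i)) Q₀ - meanSgn μ Y Q₀‖ ≤ 2 * t₀ := by
  have hk2 : (k : ℝ)⁻¹ ≤ 1 / 2 := by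
    rw [one_div]; exact inv_anti₀ (by norm_num) (by exact_mod_cast hk)
  refine norm_le_of_forall_net (T := T)
    (fun v hv => (hT v hv).imp fun w hw => ⟨hw.1, hw.2.trans hk2⟩) fun v hv => ?_
  rw [inner_sub_left, inner_empSgn, inner_meanSgn hY]
  exact (h.center v hv).le

/-- The empirical process of the sign maps is uniformly small on the ball around `Q₀`. -/
lemma NetClose.norm_increment_le (h : NetClose μ Y n x T Q₀ ρ (ρ / k) t₀ t₁)
    (hY : StronglyMeasurable Y)
    (hT : ∀ v : E, ‖v‖ ≤ 1 → ∃ w ∈ T, ‖v - w‖ ≤ (k : ℝ)⁻¹) (hk : 2 ≤ k) (hρ : 0 < ρ)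
    (hp : ∀ a ∈ T, ∫ s, sgnOsc (ρ / k) (Q₀ + ρ • a - Y s) ∂μ ≤ p) {Q : E} (hQ : ‖Q - Q₀‖ ≤ ρ) :
    ‖(empSgn n (fun i => Y (x i)) Q - empSgn n (fun i => Y (x i)) Q₀)
      - (meanSgn μ Y Q - meanSgn μ Y Q₀)‖ ≤ 4 * t₁ + 4 * p := by
  have hk0 : (0 : ℝ) < k := by
    have : 0 < k := by omega
    exact_mod_cast this
  have hη : 0 < ρ / k := by positivity
  have hk2 : (k : ℝ)⁻¹ ≤ 1 / 2 := by
    rw [one_div]; exact inv_anti₀ (by norm_num) (by exact_mod_cast hk)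
  obtain ⟨a, ha, hQa⟩ := exists_mem_net hT hρ hQ
  have h1 : ‖(empSgn n (fun i => Y (x i)) (Q₀ + ρ • a) - empSgn n (fun i => Y (x i)) Q₀)
      - (meanSgn μ Y (Q₀ + ρ • a) - meanSgn μ Y Q₀)‖ ≤ 2 * t₁ := by
    refine norm_le_of_forall_net (T := T)
      (fun v hv => (hT v hv).imp fun w hw => ⟨hw.1, hw.2.trans hk2⟩) fun v hv => ?_
    have := (h.increment a ha v hv).le
    simp_rw [inner_sub_left] at this
    rw [Finset.sum_sub_distrib, mul_sub, integral_sub ((integrable_sgn hY _).inner_const v)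
      ((integrable_sgn hY _).inner_const v)] at this
    rw [inner_sub_left, inner_sub_left, inner_sub_left, inner_empSgn, inner_empSgn,
      inner_meanSgn hY, inner_meanSgn hY]
    exact this
  have h2 := norm_empSgn_sub_empSgn_le (n := n) (y := fun i => Y (x i)) hη hQa
  have h3 := norm_meanSgn_sub_le (μ := μ) hY hη hQa
  have h4 := h.oscillation a ha
  have h5 := hp a ha
  have h6 : (empSgn n (fun i => Y (x i)) Q - empSgn n (fun i => Y (x i)) Q₀)
      - (meanSgn μ Y Q - meanSgn μ Y Q₀)
    = ((empSgn n (fun i => Y (x i)) (Q₀ + ρ • a) - empSgn n (fun i => Y (x i)) Q₀)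
      - (meanSgn μ Y (Q₀ + ρ • a) - meanSgn μ Y Q₀))
      + (empSgn n (fun i => Y (x i)) Q - empSgn n (fun i => Y (x i)) (Q₀ + ρ • a))
      - (meanSgn μ Y Q - meanSgn μ Y (Q₀ + ρ • a)) := by abel
  rw [h6]
  refine (norm_sub_le _ _).trans ((add_le_add_left (norm_add_le _ _) _).trans ?_)
  linarith

open scoped Classical in
/-- Few observations coincide with a given point of the ball around `Q₀`. -/
lemma NetClose.coincidence_le (h : NetClose μ Y n x T Q₀ ρ (ρ / k) t₀ t₁)
    (hT : ∀ v : E, ‖v‖ ≤ 1 → ∃ w ∈ T, ‖v - w‖ ≤ (k : ℝ)⁻¹) (hk : 2 ≤ k) (hρ : 0 < ρ)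
    (hp : ∀ a ∈ T, ∫ s, sgnOsc (ρ / k) (Q₀ + ρ • a - Y s) ∂μ ≤ p) {Q : E} (hQ : ‖Q - Q₀‖ ≤ ρ) :
    (n : ℝ)⁻¹ * ∑ i ∈ Finset.range n, (if Q - Y (x i) = 0 then (1 : ℝ) else 0) ≤ t₁ + p := by
  have hk0 : (0 : ℝ) < k := by
    have : 0 < k := by omega
    exact_mod_cast this
  have hη : 0 < ρ / k := by positivity
  obtain ⟨a, ha, hQa⟩ := exists_mem_net hT hρ hQ
  have h4 := h.oscillation a ha
  have h5 := hp a ha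
  have h6 : ∑ i ∈ Finset.range n, (if Q - Y (x i) = 0 then (1 : ℝ) else 0)
      ≤ ∑ i ∈ Finset.range n, sgnOsc (ρ / k) (Q₀ + ρ • a - Y (x i)) := by
    refine Finset.sum_le_sum fun i _ => ?_
    split_ifs with h0
    · rw [← sub_eq_zero.1 h0, sgnOsc_eq_one hη]
      rwa [norm_sub_rev]
    · exact sgnOsc_nonneg hη _
  have h7 := mul_le_mul_of_nonneg_left h6 (show 0 ≤ (n : ℝ)⁻¹ by positivity)
  linarith

/-- The deterministic core of the linear representation. On the event `NetClose` a minimizer of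
the sample objective function lies within `ρ` of the zero `Q₀` of the population gradient, by
strong monotonicity on the sphere of radius `ρ`, and is then given by one Newton step up to
an error of second order. -/
lemma NetClose.norm_linearization_le {κ K w C} {Qhat : E}
    (h : NetClose μ Y n x T Q₀ ρ (ρ / k) t₀ t₁) (hY : StronglyMeasurable Y)
    (hT : ∀ v : E, ‖v‖ ≤ 1 → ∃ w ∈ T, ‖v - w‖ ≤ (k : ℝ)⁻¹) (hk : 2 ≤ k) (hρ : 0 < ρ)
    (hp : ∀ a ∈ T, ∫ s, sgnOsc (ρ / k) (Q₀ + ρ • a - Y s) ∂μ ≤ p)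
    (hK : InvSqMomentLE μ Y C K) (hK0 : 0 ≤ K) (hC : ‖Q₀‖ ≤ C) (hw : meanSgn μ Y Q₀ = w)
    (hmono : ∀ Q, ‖Q - Q₀‖ ≤ ρ →
      κ * ‖Q - Q₀‖ ^ 2 ≤ inner ℝ (meanSgn μ Y Q - meanSgn μ Y Q₀) (Q - Q₀))
    (hκ : 2 * t₀ + (4 * t₁ + 4 * p) < κ * ρ)
    (hmin : ∀ Q', empObjective n (fun i => Y (x i)) w Qhat
      ≤ empObjective n (fun i => Y (x i)) w Q') :
    ‖meanHessian μ Y Q₀ (Qhat - Q₀) + (empSgn n (fun i => Y (x i)) Q₀ - w)‖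
      ≤ 4 * ρ ^ 2 * K + 5 * (t₁ + p) := by
  have hball : ‖Qhat - Q₀‖ ≤ ρ := by
    by_contra hlt
    push Not at hlt
    set r := ‖Qhat - Q₀‖
    have hr : 0 < r := hρ.trans hlt
    set e := r⁻¹ • (Qhat - Q₀) with he
    have he1 : ‖e‖ = 1 := by
      rw [he, norm_smul, norm_inv, Real.norm_of_nonneg hr.le, inv_mul_cancel₀ hr.ne']
    have hQQ : Q₀ + ρ • e - Q₀ = ρ • e := add_sub_cancel_left _ _
    have hn : ‖Q₀ + ρ • e - Q₀‖ = ρ := by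
      rw [hQQ, norm_smul, he1, mul_one, Real.norm_of_nonneg hρ.le]
    have h1 := inner_empSgn_sub_nonpos hmin (Q₀ + ρ • e)
    have h2 : Qhat - (Q₀ + ρ • e) = (r - ρ) • e := by
      have : r • e = Qhat - Q₀ := smul_inv_smul₀ hr.ne' _
      rw [sub_smul, this]; abel
    rw [h2, inner_smul_right] at h1
    have h3 := nonpos_of_mul_nonpos_right h1 (sub_pos.2 hlt)
    have h4 := hmono _ hn.le
    rw [hn, hQQ, inner_smul_right] at h4
    have h5 : κ * ρ ≤ inner ℝ (meanSgn μ Y (Q₀ + ρ • e) - meanSgn μ Y Q₀) e := by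
      rw [pow_two, ← mul_assoc, mul_comm (κ * ρ)] at h4
      exact le_of_mul_le_mul_left h4 hρ
    have h6 := h.norm_increment_le hY hT hk hρ hp hn.le
    have h7 := h.norm_center_le hY hT hk
    have h8 : ∀ F : E, -‖F‖ ≤ inner ℝ F e := fun F => by
      have := (abs_le.1 (abs_real_inner_le_norm F e)).1
      rwa [he1, mul_one] at this
    have h9 := h8 ((empSgn n (fun i => Y (x i)) (Q₀ + ρ • e) - empSgn n (fun i => Y (x i)) Q₀)
      - (meanSgn μ Y (Q₀ + ρ • e) - meanSgn μ Y Q₀))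
    have h10 := h8 (empSgn n (fun i => Y (x i)) Q₀ - meanSgn μ Y Q₀)
    rw [← hw] at h3
    simp only [inner_sub_left] at h3 h5 h9 h10
    linarith
  have h1 := h.norm_increment_le hY hT hk hρ hp hball
  have h2 := (norm_empSgn_sub_le hmin).trans (h.coincidence_le hT hk hρ hp hball)
  have h3 := hK.norm_meanSgn_add_sub_sub_le hK0 hY hC (Qhat - Q₀)
  rw [add_sub_cancel] at h3
  have h4 : 4 * ‖Qhat - Q₀‖ ^ 2 * K ≤ 4 * ρ ^ 2 * K := by gcongr
  have h5 : meanHessian μ Y Q₀ (Qhat - Q₀) + (empSgn n (fun i => Y (x i)) Q₀ - w)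
      = (empSgn n (fun i => Y (x i)) Qhat - w)
        - ((empSgn n (fun i => Y (x i)) Qhat - empSgn n (fun i => Y (x i)) Q₀)
          - (meanSgn μ Y Qhat - meanSgn μ Y Q₀))
        - (meanSgn μ Y Qhat - meanSgn μ Y Q₀ - meanHessian μ Y Q₀ (Qhat - Q₀)) := by abel
  rw [h5]
  refine (norm_sub_le _ _).trans ((add_le_add_left (norm_sub_le _ _) _).trans ?_)
  linarith

lemma InvSqMomentLE.integral_sgnOsc_le {C K : ℝ} (hK : InvSqMomentLE μ Y C K) (hK0 : 0 ≤ K)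
    (hY : StronglyMeasurable Y) (hη : 0 < η) {Q : E} (hQ : ‖Q‖ ≤ C) :
    ∫ s, sgnOsc η (Q - Y s) ∂μ ≤ η * (1 + K) := by
  obtain ⟨h1, h2⟩ := hK.integrable_inv hK0 hY hQ
  calc _ ≤ ∫ s, η * ‖Q - Y s‖⁻¹ ∂μ := by
        refine integral_mono_ae (integrable_sgnOsc hY hη Q) (h1.const_mul η) ?_
        filter_upwards [hK.ae_ne hY hQ] with s hs
        exact sgnOsc_le_div hη hs
    _ ≤ _ := by rw [integral_const_mul]; gcongr

variable {Ω : Type*} [MeasurableSpace Ω] {P : Measure Ω} [IsProbabilityMeasure P]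
  {X : ℕ → Ω → S}

/-- The event `NetClose` has a probability exponentially close to one. -/
lemma measureReal_not_netClose_le {C K : ℝ} (hX : ∀ i, HasLaw (X i) μ P)
    (hindep : iIndepFun X P)
    (hY : StronglyMeasurable Y) (hK : InvSqMomentLE μ Y C K) (hK0 : 0 ≤ K)
    (hT2 : ∀ v ∈ T, ‖v‖ ≤ 2) (hρ : 0 < ρ) (hQ₀ : ‖Q₀‖ + 2 * ρ ≤ C) (hη : 0 < η) (hηρ : η ≤ ρ)
    (hn : 1 ≤ n) {l : ℝ} (hl : 0 ≤ l) (hl4 : l ≤ 1 / 4) {N A : ℝ} (hN : (T.card : ℝ) ≤ N)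
    (hN1 : 1 ≤ N) (hA₁ : A ≤ n * (t₁ / 8 - ρ ^ 2 * K)) (hA₀ : A ≤ n * (l * t₀ - 4 * l ^ 2)) :
    P.real {ω | ¬ NetClose μ Y n (fun i => X i ω) T Q₀ ρ η t₀ t₁}
      ≤ 3 * N ^ 2 * Real.exp (-A) := by
  have hQC : ‖Q₀‖ ≤ C := by linarith
  set f₁ : E → E → S → ℝ := fun a v s => inner ℝ (sgn (Q₀ + ρ • a - Y s) - sgn (Q₀ - Y s)) v
    with hf₁
  set f₂ : E → S → ℝ := fun v s => inner ℝ (sgn (Q₀ - Y s)) v with hf₂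
  set f₃ : E → S → ℝ := fun a s => sgnOsc η (Q₀ + ρ • a - Y s) with hf₃
  have hsm : ∀ Q : E, StronglyMeasurable fun s => sgn (Q - Y s) := fun Q =>
    stronglyMeasurable_sgn_comp (stronglyMeasurable_sub hY Q)
  set dev : (S → ℝ) → ℝ → Set Ω := fun f t =>
    {ω | t ≤ (n : ℝ)⁻¹ * ∑ i ∈ Finset.range n, f (X i ω) - ∫ s, f s ∂μ} with hdev
  have hn0 : (0 : ℝ) ≤ n := by positivity
  have hP₁ : ∀ a ∈ T, ∀ v ∈ T, P.real (dev (f₁ a v) t₁) ≤ Real.exp (-A) := by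
    intro a ha v hv
    have hB : ∀ s, |f₁ a v s| ≤ 4 := fun s => by
      refine (abs_real_inner_le_norm _ _).trans ?_
      have h1 := norm_sub_le (sgn (Q₀ + ρ • a - Y s)) (sgn (Q₀ - Y s))
      have h2 := norm_sgn_le_one (Q₀ + ρ • a - Y s)
      have h3 := norm_sgn_le_one (Q₀ - Y s)
      calc _ ≤ (2 : ℝ) * 2 := by
            gcongr
            · linarith
            · exact hT2 v hv
        _ = 4 := by norm_num
    have hσ : ∫ s, f₁ a v s ^ 2 ∂μ ≤ 64 * ρ ^ 2 * K := by
      refine (le_abs_self _).trans ?_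
      rw [← Real.norm_eq_abs]
      refine hK.norm_integral_le hK0 hY hQC (by positivity) fun s hs => ?_
      rw [norm_pow]
      have h1 : ‖f₁ a v s‖ ≤ 8 * ρ / ‖Q₀ - Y s‖ := by
        refine (norm_inner_le_norm _ _).trans ?_
        have h2 := norm_sgn_sub_sgn_le hs (Q₀ + ρ • a - Y s)
        rw [sub_sub_sub_cancel_right, add_sub_cancel_left, norm_smul,
          Real.norm_of_nonneg hρ.le] at h2
        calc _ ≤ (2 * (ρ * ‖a‖) / ‖Q₀ - Y s‖) * ‖v‖ := by gcongr
          _ ≤ (2 * (ρ * 2) / ‖Q₀ - Y s‖) * 2 := by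
              gcongr
              · exact hT2 a ha
              · exact hT2 v hv
          _ = _ := by ring
      calc _ ≤ (8 * ρ / ‖Q₀ - Y s‖) ^ 2 := by gcongr
        _ = _ := by rw [div_pow, mul_pow]; norm_num
    have hm : Measurable (f₁ a v) :=
      (((hsm _).sub (hsm _)).inner stronglyMeasurable_const).measurable
    refine (measureReal_empirical_ge_le hX hindep hm hB hσ (l := 1 / 8) (by norm_num)
      (by norm_num) hn t₁).trans (Real.exp_le_exp.2 (neg_le_neg (hA₁.trans_eq ?_)))
    ring
  have hP₂ : ∀ v ∈ T, P.real (dev (f₂ v) t₀) ≤ Real.exp (-A) := by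
    intro v hv
    have hB : ∀ s, |f₂ v s| ≤ 2 := fun s => by
      refine (abs_real_inner_le_norm _ _).trans ?_
      calc _ ≤ (1 : ℝ) * 2 := by
            gcongr
            · exact norm_sgn_le_one _
            · exact hT2 v hv
        _ = 2 := by norm_num
    have hσ : ∫ s, f₂ v s ^ 2 ∂μ ≤ 4 := by
      have := norm_integral_le_of_norm_le_const (μ := μ) (f := fun s => f₂ v s ^ 2) (C := 4)
        (ae_of_all _ fun s => by
          rw [norm_pow, Real.norm_eq_abs]
          calc _ ≤ (2 : ℝ) ^ 2 := by gcongr; exact hB s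
            _ = 4 := by norm_num)
      exact (le_abs_self _).trans (by simpa using this)
    have hm : Measurable (f₂ v) := ((hsm _).inner stronglyMeasurable_const).measurable
    refine (measureReal_empirical_ge_le hX hindep hm hB hσ hl
      (by linarith) hn t₀).trans (Real.exp_le_exp.2 (neg_le_neg (hA₀.trans_eq ?_)))
    ring
  have hP₃ : ∀ a ∈ T, P.real (dev (f₃ a) t₁) ≤ Real.exp (-A) := by
    intro a ha
    have hB : ∀ s, |f₃ a s| ≤ 1 := fun s => by
      rw [abs_of_nonneg (sgnOsc_nonneg hη _)]; exact sgnOsc_le_one hη _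
    have hQa : ‖Q₀ + ρ • a‖ ≤ C := by
      refine (norm_add_le _ _).trans ?_
      rw [norm_smul, Real.norm_of_nonneg hρ.le]
      nlinarith [hT2 a ha]
    have hσ : ∫ s, f₃ a s ^ 2 ∂μ ≤ 64 * ρ ^ 2 * K := by
      refine (le_abs_self _).trans ?_
      rw [← Real.norm_eq_abs]
      refine hK.norm_integral_le hK0 hY hQa (by positivity) fun s hs => ?_
      rw [norm_pow, Real.norm_of_nonneg (sgnOsc_nonneg hη _)]
      have h0 := sgnOsc_nonneg hη (Q₀ + ρ • a - Y s)
      calc _ ≤ (η / ‖Q₀ + ρ • a - Y s‖) ^ 2 := by gcongr; exact sgnOsc_le_div hη hs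
        _ = η ^ 2 / ‖Q₀ + ρ • a - Y s‖ ^ 2 := div_pow _ _ _
        _ ≤ _ := by gcongr; nlinarith
    refine (measureReal_empirical_ge_le hX hindep (measurable_sgnOsc hY η _) hB hσ
      (l := 1 / 8) (by norm_num)
      (by norm_num) hn t₁).trans (Real.exp_le_exp.2 (neg_le_neg (hA₁.trans_eq ?_)))
    ring
  have hsub : {ω | ¬ NetClose μ Y n (fun i => X i ω) T Q₀ ρ η t₀ t₁}
      ⊆ ((⋃ q ∈ T ×ˢ T, dev (f₁ q.1 q.2) t₁) ∪ ⋃ v ∈ T, dev (f₂ v) t₀)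
        ∪ ⋃ a ∈ T, dev (f₃ a) t₁ := by
    intro ω hω
    by_contra hc
    simp only [Set.mem_union, Set.mem_iUnion, not_or, not_exists] at hc
    refine hω ⟨fun a ha v hv => ?_, fun v hv => ?_, fun a ha => ?_⟩
    · exact not_le.1 (hc.1.1 (a, v) (Finset.mk_mem_product ha hv))
    · exact not_le.1 (hc.1.2 v hv)
    · exact not_le.1 (hc.2 a ha)
  have hcard : ∀ {ι : Type _} (U : Finset ι) (s : ι → Set Ω),
      (∀ i ∈ U, P.real (s i) ≤ Real.exp (-A)) →
        P.real (⋃ i ∈ U, s i) ≤ U.card * Real.exp (-A) := fun U s hs =>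
    (measureReal_biUnion_finset_le _ _).trans
      ((Finset.sum_le_sum hs).trans_eq (by rw [Finset.sum_const, nsmul_eq_mul]))
  have e1 := hcard (T ×ˢ T) (fun q => dev (f₁ q.1 q.2) t₁) fun q hq =>
    hP₁ _ (Finset.mem_product.1 hq).1 _ (Finset.mem_product.1 hq).2
  have e2 := hcard T (fun v => dev (f₂ v) t₀) hP₂
  have e3 := hcard T (fun a => dev (f₃ a) t₁) hP₃
  have hexp := Real.exp_pos (-A)
  have hc0 : (0 : ℝ) ≤ T.card := by positivity
  calc _ ≤ _ := measureReal_mono hsub (measure_ne_top _ _)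
    _ ≤ ((T ×ˢ T).card * Real.exp (-A) + T.card * Real.exp (-A)) + T.card * Real.exp (-A) :=
        (measureReal_union_le _ _).trans
          (add_le_add ((measureReal_union_le _ _).trans (add_le_add e1 e2)) e3)
    _ ≤ (N ^ 2 * Real.exp (-A) + N ^ 2 * Real.exp (-A)) + N ^ 2 * Real.exp (-A) := by
        have : (T.card : ℝ) ≤ N ^ 2 := by nlinarith
        rw [Finset.card_product]
        push_cast
        gcongr
        nlinarith
    _ = _ := by ring

end Linearization

/-! ### Invertibility of the Hessian -/

section HessianInverse

variable {E : Type*} [NormedAddCommGroup E] [InnerProductSpace ℝ E] [FiniteDimensional ℝ E]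
  {S : Type*} [MeasurableSpace S] {μ : Measure S} [IsProbabilityMeasure μ] {Y : S → E}
  {C K κ : ℝ}

/-- Strong monotonicity of the gradient passes to its derivative. -/
lemma InvSqMomentLE.le_inner_meanHessian (hK : InvSqMomentLE μ Y C K) (hK0 : 0 ≤ K)
    (hY : StronglyMeasurable Y) {Q : E} (hQ : ‖Q‖ ≤ C) {r : ℝ} (hr : 0 < r)
    (hmono : ∀ Q', ‖Q' - Q‖ ≤ r →
      κ * ‖Q' - Q‖ ^ 2 ≤ inner ℝ (meanSgn μ Y Q' - meanSgn μ Y Q) (Q' - Q)) (h : E) :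
    κ * ‖h‖ ^ 2 ≤ inner ℝ (meanHessian μ Y Q h) h := by
  have hstep : ∀ t : ℝ, 0 < t → t * ‖h‖ ≤ r →
      κ * ‖h‖ ^ 2 ≤ inner ℝ (meanHessian μ Y Q h) h + t * (4 * ‖h‖ ^ 3 * K) := by
    intro t ht htr
    have hn : ‖t • h‖ = t * ‖h‖ := by rw [norm_smul, Real.norm_of_nonneg ht.le]
    have h1 := hmono (Q + t • h) (by rwa [add_sub_cancel_left, hn])
    have h2 := hK.norm_meanSgn_add_sub_sub_le hK0 hY hQ (t • h)
    rw [add_sub_cancel_left, hn] at h1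
    rw [hn] at h2
    have h3 := real_inner_le_norm
      (meanSgn μ Y (Q + t • h) - meanSgn μ Y Q - meanHessian μ Y Q (t • h)) (t • h)
    rw [inner_sub_left, hn] at h3
    have h4 : inner ℝ (meanHessian μ Y Q (t • h)) (t • h)
        = t ^ 2 * inner ℝ (meanHessian μ Y Q h) h := by
      rw [map_smul, real_inner_smul_left, real_inner_smul_right]; ring
    have h5 : ‖meanSgn μ Y (Q + t • h) - meanSgn μ Y Q - meanHessian μ Y Q (t • h)‖ * (t * ‖h‖)
        ≤ 4 * (t * ‖h‖) ^ 2 * K * (t * ‖h‖) := by gcongr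
    have h6 : t ^ 2 * (κ * ‖h‖ ^ 2)
        ≤ t ^ 2 * (inner ℝ (meanHessian μ Y Q h) h + t * (4 * ‖h‖ ^ 3 * K)) := by
      rw [h4] at h3; nlinarith
    exact le_of_mul_le_mul_left h6 (by positivity)
  have hlim : Tendsto (fun t : ℝ => inner ℝ (meanHessian μ Y Q h) h + t * (4 * ‖h‖ ^ 3 * K))
      (𝓝[>] 0) (𝓝 (inner ℝ (meanHessian μ Y Q h) h + 0 * (4 * ‖h‖ ^ 3 * K))) :=
    Tendsto.mono_left (Continuous.tendsto (by fun_prop) _) nhdsWithin_le_nhds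
  rw [zero_mul, add_zero] at hlim
  refine ge_of_tendsto hlim ?_
  have hsmall : ∀ᶠ t : ℝ in 𝓝[>] 0, t * ‖h‖ ≤ r := by
    have : Tendsto (fun t : ℝ => t * ‖h‖) (𝓝[>] 0) (𝓝 (0 * ‖h‖)) :=
      Tendsto.mono_left (Continuous.tendsto (by fun_prop) _) nhdsWithin_le_nhds
    rw [zero_mul] at this
    exact (this.eventually_lt_const hr).mono fun _ => le_of_lt
  filter_upwards [hsmall, self_mem_nhdsWithin] with t ht1 ht0
  exact hstep t ht0 ht1

lemma mul_norm_le_norm_of_coercive {A : E →L[ℝ] E}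
    (hA : ∀ h, κ * ‖h‖ ^ 2 ≤ inner ℝ (A h) h) (h : E) : κ * ‖h‖ ≤ ‖A h‖ := by
  rcases (norm_nonneg h).eq_or_lt with h0 | h0
  · rw [← h0, mul_zero]; positivity
  · have h1 := (hA h).trans (real_inner_le_norm _ _)
    rw [pow_two, ← mul_assoc] at h1
    exact le_of_mul_le_mul_right h1 h0

lemma exists_equiv_of_coercive (hκ : 0 < κ) {A : E →L[ℝ] E}
    (hA : ∀ h, κ * ‖h‖ ^ 2 ≤ inner ℝ (A h) h) : ∃ J : E ≃L[ℝ] E, (J : E →L[ℝ] E) = A := by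
  have hinj : Function.Injective (A : E →ₗ[ℝ] E) := by
    rw [injective_iff_map_eq_zero]
    intro h hh
    have h1 := mul_norm_le_norm_of_coercive hA h
    have h2 : A h = 0 := hh
    rw [h2, norm_zero] at h1
    have h3 : ‖h‖ ≤ 0 := by
      by_contra hc
      push Not at hc
      nlinarith [mul_pos hκ hc]
    exact norm_le_zero_iff.1 h3
  exact ⟨(LinearEquiv.ofInjectiveEndo (A : E →ₗ[ℝ] E) hinj).toContinuousLinearEquiv, by
    ext h; rfl⟩

end HessianInverse

/-! ### Coordinate truncations -/

section Truncation

variable {H : Type*} [NormedAddCommGroup H] [InnerProductSpace ℝ H] {φ : ℕ → H} {m m' : ℕ}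

instance finiteDimensional_Zspan (φ : ℕ → H) (m : ℕ) : FiniteDimensional ℝ (Zspan φ m) :=
  FiniteDimensional.span_of_finite ℝ ((Set.finite_lt_nat m).image φ)

lemma finrank_Zspan_le (φ : ℕ → H) (m : ℕ) : Module.finrank ℝ (Zspan φ m) ≤ m := by
  classical
  have h : φ '' {k : ℕ | k < m} = ((Finset.range m).image φ : Finset H) := by
    ext x; simp
  rw [Zspan, h]
  exact (finrank_span_finset_le_card _).trans (Finset.card_image_le.trans (by simp))

lemma coe_trunc (φ : ℕ → H) (m : ℕ) (z : H) :
    (trunc φ m z : H) = ∑ k : Fin m, (inner ℝ (φ k) z) • φ k :=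
   (Fin.sum_univ_eq_sum_range (fun k => (inner ℝ (φ k) z : ℝ) • φ k) m).symm

lemma trunc_sub (φ : ℕ → H) (m : ℕ) (x y : H) :
    trunc φ m (x - y) = trunc φ m x - trunc φ m y := by
  ext
  rw [AddSubgroupClass.coe_sub, coe_trunc, coe_trunc, coe_trunc, ← Finset.sum_sub_distrib]
  simp_rw [inner_sub_right, sub_smul]

lemma continuous_trunc (φ : ℕ → H) (m : ℕ) : Continuous (trunc φ m) := by
  refine Continuous.subtype_mk ?_ _
  fun_prop

lemma norm_trunc_le (hφ : Orthonormal ℝ fun k : Fin m => φ k) (z : H) : ‖trunc φ m z‖ ≤ ‖z‖ := by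
  refine le_of_sq_le_sq ?_ (norm_nonneg _)
  have h1 : ‖trunc φ m z‖ ^ 2 = ∑ k : Fin m, ‖(inner ℝ (φ k) z : ℝ)‖ ^ 2 := by
    rw [← Submodule.norm_coe, ← real_inner_self_eq_norm_sq, coe_trunc, hφ.inner_sum]
    refine Finset.sum_congr rfl fun k _ => ?_
    rw [Real.norm_eq_abs, sq_abs, pow_two]; rfl
  rw [h1]
  exact hφ.sum_inner_products_le z

lemma trunc_trunc (hφ : Orthonormal ℝ fun k : Fin m' => φ k) (hm : m ≤ m') (z : H) :
    trunc φ m (trunc φ m' z : H) = trunc φ m z := by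
  ext
  rw [coe_trunc, coe_trunc φ m z]
  refine Finset.sum_congr rfl fun k _ => ?_
  congr 1
  rw [coe_trunc]
  exact hφ.inner_right_sum (fun j : Fin m' => (inner ℝ (φ j) z : ℝ))
    (Finset.mem_univ (⟨k, k.2.trans_le hm⟩ : Fin m'))

lemma orthonormal_fin {N : ℕ∞} (hφ : IsOrthonormalBasisSeq N φ) (hm : (m : ℕ∞) ≤ N) :
    Orthonormal ℝ fun k : Fin m => φ k :=
  hφ.orthonormal.comp
    (fun k : Fin m => (⟨k, (Nat.cast_lt.2 k.2).trans_le hm⟩ : {k : ℕ // (k : ℕ∞) < N}))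
    fun a b h => Fin.ext (by simpa using h)

lemma orthonormal_fin_mono (hφ : Orthonormal ℝ fun k : Fin m' => φ k) (hm : m ≤ m') :
    Orthonormal ℝ fun k : Fin m => φ k :=
  hφ.comp (Fin.castLE hm) (Fin.castLE_injective hm)

variable [MeasurableSpace H] [BorelSpace H] {μ : Measure H} {C K : ℝ}

lemma stronglyMeasurable_trunc (φ : ℕ → H) (m : ℕ) : StronglyMeasurable (trunc φ m) :=
  have : SecondCountableTopology (Zspan φ m) := inferInstance
  (continuous_trunc φ m).stronglyMeasurable

/-- Negative moment bounds improve with the dimension: passing to fewer coordinates decreases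
the distances. -/
lemma InvSqMomentLE.of_le (hφ : Orthonormal ℝ fun k : Fin m' => φ k) (hm : m ≤ m')
    (h : InvSqMomentLE μ (trunc φ m) C K) : InvSqMomentLE μ (trunc φ m') C K := by
  intro Q hQ
  have hm' := orthonormal_fin_mono hφ hm
  refine (lintegral_mono fun x => ?_).trans (h (trunc φ m (Q : H)) ((norm_trunc_le hm' _).trans hQ))
  have h1 : ‖trunc φ m (Q : H) - trunc φ m x‖ ≤ ‖Q - trunc φ m' x‖ := by
    have := norm_trunc_le hm' ((Q : H) - (trunc φ m' x : H))
    rw [trunc_sub, trunc_trunc hφ hm] at this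
    exact this
  gcongr
  exact enorm_le_iff_norm_le.2 h1

variable {d : ℕ → ℕ}

/-- The bound in the moment condition can be chosen independent of `n`. -/
lemma AssumptionB.exists_invSqMomentLE (hB : AssumptionB μ φ d)
    (hφ : ∀ n, Orthonormal ℝ fun k : Fin (d n) => φ k) {C : ℝ} (hC : 0 < C) :
    ∃ K, 0 ≤ K ∧ ∀ᶠ n in atTop, InvSqMomentLE μ (trunc φ (d n)) C K := by
  obtain ⟨n₁, hn₁⟩ := eventually_atTop.1 (hB.moment C hC)
  -- among the admissible indices, one of the smallest dimension serves for all
  obtain ⟨⟨n₀, hn₀⟩, hmin⟩ : ∃ i : {n // n₁ ≤ n}, ∀ j : {n // n₁ ≤ n}, d i ≤ d j := by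
    have : Nonempty {n // n₁ ≤ n} := ⟨⟨n₁, le_rfl⟩⟩
    exact ⟨Function.argmin (fun i : {n // n₁ ≤ n} => d i),
      fun j => Function.argmin_le (fun i : {n // n₁ ≤ n} => d i) j⟩
  refine ⟨(⨆ (Q : Zspan φ (d n₀)) (_ : ‖Q‖ ≤ C),
      ∫⁻ x, (‖Q - trunc φ (d n₀) x‖ₑ ^ 2)⁻¹ ∂μ).toReal, ENNReal.toReal_nonneg, ?_⟩
  filter_upwards [eventually_ge_atTop n₁] with n hn
  refine InvSqMomentLE.of_le (hφ n) (hmin ⟨n, hn⟩) fun Q hQ => ?_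
  rw [ENNReal.ofReal_toReal (hn₁ n₀ hn₀).ne]
  exact le_iSup₂ (f := fun (Q : Zspan φ (d n₀)) (_ : ‖Q‖ ≤ C) =>
    ∫⁻ x, (‖Q - trunc φ (d n₀) x‖ₑ ^ 2)⁻¹ ∂μ) Q hQ

end Truncation

/-! ### Population quantiles -/

section Quantile

variable {H : Type*} [NormedAddCommGroup H] [InnerProductSpace ℝ H] [MeasurableSpace H]
  [BorelSpace H] {μ : Measure H} [IsProbabilityMeasure μ] {φ : ℕ → H} {d : ℕ → ℕ} {u : H}

lemma exists_measureReal_norm_gt_le (μ : Measure H) [IsProbabilityMeasure μ] {p : ℝ} (hp : 0 < p) :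
    ∃ M : ℝ, 0 < M ∧ μ.real {x | M < ‖x‖} ≤ p := by
  have hmono : Monotone fun k : ℕ => {x : H | ‖x‖ ≤ k} := fun a b hab x hx =>
    le_trans (show ‖x‖ ≤ a from hx) (Nat.cast_le.2 hab)
  have hU : ⋃ k : ℕ, {x : H | ‖x‖ ≤ k} = Set.univ :=
    Set.eq_univ_of_forall fun x => Set.mem_iUnion.2 (exists_nat_ge ‖x‖)
  have h1 := tendsto_measure_iUnion_atTop (μ := μ) hmono
  rw [hU, measure_univ] at h1
  have h2 : Tendsto (fun k : ℕ => μ.real {x : H | ‖x‖ ≤ k}) atTop (𝓝 1) :=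
    (ENNReal.tendsto_toReal ENNReal.one_ne_top).comp h1
  obtain ⟨k, hk, hk1⟩ := ((h2.eventually_const_lt (show 1 - p < 1 by linarith)).and
    (eventually_ge_atTop 1)).exists
  refine ⟨k, by exact_mod_cast hk1, ?_⟩
  have hms : MeasurableSet {x : H | ‖x‖ ≤ k} := measurableSet_le measurable_norm measurable_const
  have h3 : {x : H | (k : ℝ) < ‖x‖} = {x : H | ‖x‖ ≤ k}ᶜ := by ext x; simp
  rw [h3, probReal_compl_eq_one_sub hms]
  linarith

/-- The properties of the population objective function that hold uniformly in the dimension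
`m` from some index on: the population quantiles exist and are unique, and lie in the ball of radius
`C`; the negative moments are bounded by `K`, and the gradient is strongly monotone with
constant `κ`, on slightly larger balls. -/
structure UniformBounds (μ : Measure H) (φ : ℕ → H) (m : ℕ) (u : H) (C K κ : ℝ) : Prop where
  existsUnique : ∃! Q : Zspan φ m, IsPopQuantile μ φ m u Q
  norm_le : ∀ Q : Zspan φ m, IsPopQuantile μ φ m u Q → ‖Q‖ ≤ C
  moment : InvSqMomentLE μ (trunc φ m) (C + 1) K
  mono : ∀ Q Q' : Zspan φ m, ‖Q‖ ≤ C + 1 → ‖Q'‖ ≤ C + 1 →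
    κ * ‖Q' - Q‖ ^ 2
      ≤ inner ℝ (meanSgn μ (trunc φ m) Q' - meanSgn μ (trunc φ m) Q) (Q' - Q)

lemma AssumptionB.exists_uniformBounds (hB : AssumptionB μ φ d)
    (hφ : ∀ n, Orthonormal ℝ fun k : Fin (d n) => φ k) (hu : ‖u‖ < 1) :
    ∃ C K κ, 0 ≤ K ∧ 0 < κ ∧ ∀ᶠ n in atTop, UniformBounds μ φ (d n) u C K κ := by
  obtain ⟨M, hM, hMp⟩ := exists_measureReal_norm_gt_le μ (p := (1 - ‖u‖) / 4) (by linarith)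
  have hu1 : 0 < 1 - ‖u‖ := by linarith
  set C : ℝ := 4 * M / (1 - ‖u‖) with hC
  have hC0 : 0 < C := by positivity
  obtain ⟨K, hK0, hK⟩ := hB.exists_invSqMomentLE hφ (C := 2 * (C + 1) + M + 1) (by positivity)
  -- a tube of this radius has mass at most `1 / 4`
  set ε : ℝ := min 1 (1 / (16 * (K + 1) * (2 * (M + (C + 1)) + 3))) with hε
  have hden : 0 < 16 * (K + 1) * (2 * (M + (C + 1)) + 3) := by positivity
  have hε0 : 0 < ε := lt_min one_pos (by positivity)
  have hε1 : ε ≤ 1 := min_le_left _ _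
  have hεK : 4 * K * ε * (2 * (M + (C + 1)) + 3) ≤ 1 / 4 := by
    have h1 : ε * (16 * (K + 1) * (2 * (M + (C + 1)) + 3)) ≤ 1 := by
      rw [← le_div_iff₀ hden]; exact min_le_right _ _
    have h2 : 0 ≤ ε * (2 * (M + (C + 1)) + 3) := by positivity
    nlinarith
  refine ⟨C, K, ε ^ 2 / (4 * (M + (C + 1)) ^ 3), hK0, by positivity, ?_⟩
  filter_upwards [hK] with n hKn
  have hY := stronglyMeasurable_trunc φ (d n)
  have htail : μ.real {x | M < ‖trunc φ (d n) x‖} ≤ (1 - ‖u‖) / 4 :=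
    (measureReal_mono (fun x (hx : M < ‖trunc φ (d n) x‖) =>
      hx.trans_le (norm_trunc_le (hφ n) x)) (measure_ne_top _ _)).trans hMp
  have hmass : 1 / 2 ≤ μ.real {x | ‖trunc φ (d n) x‖ ≤ M} := by
    have hms : MeasurableSet {x | M < ‖trunc φ (d n) x‖} :=
      measurableSet_lt measurable_const hY.norm.measurable
    have h3 : {x | ‖trunc φ (d n) x‖ ≤ M} = {x | M < ‖trunc φ (d n) x‖}ᶜ := by ext x; simp
    rw [h3, probReal_compl_eq_one_sub hms]
    linarith [norm_nonneg u]
  have hmoment : InvSqMomentLE μ (trunc φ (d n)) (C + 1) K := hKn.mono (by linarith)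
  have hmono : ∀ Q Q' : Zspan φ (d n), ‖Q‖ ≤ C + 1 → ‖Q'‖ ≤ C + 1 →
      ε ^ 2 / (4 * (M + (C + 1)) ^ 3) * ‖Q' - Q‖ ^ 2
        ≤ inner ℝ (meanSgn μ (trunc φ (d n)) Q' - meanSgn μ (trunc φ (d n)) Q) (Q' - Q) :=
    fun Q Q' hQ hQ' => hKn.le_inner_meanSgn_sub hK0 hY hM hmass hε0 hε1 hεK hQ hQ'
  have hcoer : ∀ Q : Zspan φ (d n),
      (1 - ‖u‖) / 2 * ‖Q‖ - 2 * M ≤ popObjective μ φ (d n) u Q := by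
    intro Q
    have h1 := le_integral_norm_sub (μ := μ) hY hM.le htail Q
    have h2 := real_inner_le_norm (trunc φ (d n) u) Q
    have h3 := norm_trunc_le (hφ n) u
    rw [popObjective]
    nlinarith [norm_nonneg Q]
  have hle : ∀ Q : Zspan φ (d n), IsPopQuantile μ φ (d n) u Q → ‖Q‖ ≤ C := by
    intro Q hQ
    have h1 := (hcoer Q).trans (hQ 0)
    have h2 : popObjective μ φ (d n) u 0 = 0 := by simp [popObjective]
    rw [h2] at h1
    rw [hC, le_div_iff₀ hu1]
    linarith
  refine ⟨?_, hle, hmoment, hmono⟩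
  obtain ⟨Q, hQ⟩ := exists_forall_le_of_coercive
    (f := popObjective μ φ (d n) u)
    ((continuous_integral_norm_sub hY).sub (continuous_const.inner continuous_id))
    (by linarith : 0 < (1 - ‖u‖) / 2) hcoer
  refine ⟨Q, hQ, fun Q' hQ' => ?_⟩
  have hg : ∀ R : Zspan φ (d n), IsPopQuantile μ φ (d n) u R →
      meanSgn μ (trunc φ (d n)) R = trunc φ (d n) u := fun R hR =>
    hmoment.meanSgn_eq_of_isMin hK0 hY ((hle R hR).trans (by linarith)) hR
  have h1 := hmono Q Q' ((hle Q hQ).trans (by linarith)) ((hle Q' hQ').trans (by linarith))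
  rw [hg Q hQ, hg Q' hQ', sub_self, inner_zero_left] at h1
  have hκ : 0 < ε ^ 2 / (4 * (M + (C + 1)) ^ 3) := by positivity
  have h2 : ‖Q' - Q‖ ^ 2 ≤ 0 := by
    by_contra hc
    push Not at hc
    nlinarith [mul_pos hκ hc]
  have h3 : ‖Q' - Q‖ = 0 := by
    have := norm_nonneg (Q' - Q)
    nlinarith
  exact sub_eq_zero.1 (norm_eq_zero.1 h3)

variable {m : ℕ} {C K κ : ℝ}

lemma UniformBounds.meanSgn_eq (h : UniformBounds μ φ m u C K κ) (hK0 : 0 ≤ K) {Q : Zspan φ m}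
    (hQ : IsPopQuantile μ φ m u Q) : meanSgn μ (trunc φ m) Q = trunc φ m u :=
  h.moment.meanSgn_eq_of_isMin hK0 (stronglyMeasurable_trunc φ m)
    ((h.norm_le Q hQ).trans (by linarith)) hQ

lemma UniformBounds.mono_of_isPopQuantile (h : UniformBounds μ φ m u C K κ) {Q : Zspan φ m}
    (hQ : IsPopQuantile μ φ m u Q) {Q' : Zspan φ m} (hQ' : ‖Q' - Q‖ ≤ 1) :
    κ * ‖Q' - Q‖ ^ 2
      ≤ inner ℝ (meanSgn μ (trunc φ m) Q' - meanSgn μ (trunc φ m) Q) (Q' - Q) := by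
  have h1 := h.norm_le Q hQ
  have h2 : ‖Q'‖ ≤ ‖Q' - Q‖ + ‖Q‖ := by
    have := norm_add_le (Q' - Q) Q
    rwa [sub_add_cancel] at this
  exact h.mono Q Q' (by linarith) (by linarith)

lemma UniformBounds.le_inner_meanHessian (h : UniformBounds μ φ m u C K κ) (hK0 : 0 ≤ K)
    {Q : Zspan φ m} (hQ : IsPopQuantile μ φ m u Q) (v : Zspan φ m) :
    κ * ‖v‖ ^ 2 ≤ inner ℝ (meanHessian μ (trunc φ m) Q v) v :=
  h.moment.le_inner_meanHessian hK0 (stronglyMeasurable_trunc φ m)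
    ((h.norm_le Q hQ).trans (by linarith)) one_pos (fun _ => h.mono_of_isPopQuantile hQ) v

lemma isHessianOperator_meanHessian (hK : InvSqMomentLE μ (trunc φ m) C K) (hK0 : 0 ≤ K)
    {Q : Zspan φ m} (hQ : ‖Q‖ ≤ C) :
    IsHessianOperator μ φ m u Q (meanHessian μ (trunc φ m) Q) := by
  have hY := stronglyMeasurable_trunc φ m
  refine ⟨hK.meanHessian_symm hK0 hY hQ, fun h => ?_⟩
  have hgrad : popGradient μ φ m u Q = meanSgn μ (trunc φ m) Q - trunc φ m u := by
    rw [popGradient, integral_sub (integrable_sgn hY Q) (integrable_const _), meanSgn]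
    simp
  have hbound : ∀ t : ℝ, t ≠ 0 → |popObjective μ φ m u (Q + t • h) - popObjective μ φ m u Q
        - t * inner ℝ (popGradient μ φ m u Q) h
        - t ^ 2 / 2 * inner ℝ (meanHessian μ (trunc φ m) Q h) h| / t ^ 2
      ≤ |t| * (8 * ‖h‖ ^ 3 * K) := by
    intro t ht
    have h1 := hK.abs_integral_norm_sub_le hK0 hY hQ (t • h)
    rw [norm_smul, Real.norm_eq_abs] at h1
    have ht2 : 0 < t ^ 2 := by positivity
    rw [div_le_iff₀ ht2]
    have h2 : |t| * (8 * ‖h‖ ^ 3 * K) * t ^ 2 = 8 * (|t| * ‖h‖) ^ 3 * K := by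
      rw [← sq_abs t]; ring
    rw [h2]
    refine le_trans (le_of_eq ?_) h1
    congr 1
    rw [hgrad, popObjective, popObjective, inner_add_right, inner_sub_left, map_smul,
      real_inner_smul_left, real_inner_smul_right, real_inner_smul_right, real_inner_smul_right]
    ring
  have hlim : Tendsto (fun t : ℝ => |t| * (8 * ‖h‖ ^ 3 * K)) (𝓝[≠] 0)
      (𝓝 (|0| * (8 * ‖h‖ ^ 3 * K))) :=
    Tendsto.mono_left (Continuous.tendsto (by fun_prop) _) nhdsWithin_le_nhds
  rw [abs_zero, zero_mul] at hlim
  exact squeeze_zero' (Eventually.of_forall fun t => by positivity)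
    (eventually_nhdsWithin_of_forall hbound) hlim

end Quantile

/-! ### The rate of convergence -/

section Rate

/-- The rate `√(ln n / n ^ (2 α))` at which the sample quantiles converge. -/
def rate (α : ℝ) (n : ℕ) : ℝ := √(Real.log n / (n : ℝ) ^ (2 * α))

lemma rate_sq (α : ℝ) (n : ℕ) : rate α n ^ 2 = Real.log n / (n : ℝ) ^ (2 * α) :=
  Real.sq_sqrt (div_nonneg (Real.log_natCast_nonneg n) (by positivity))

lemma tendsto_rate {α : ℝ} (hα : 0 < α) : Tendsto (rate α) atTop (𝓝 0) := by
  have h1 : Tendsto (fun x : ℝ => Real.log x / x ^ (2 * α)) atTop (𝓝 0) :=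
    (isLittleO_log_rpow_atTop (show 0 < 2 * α by positivity)).tendsto_div_nhds_zero
  have h2 := (h1.comp tendsto_natCast_atTop_atTop).sqrt
  rw [Real.sqrt_zero] at h2
  exact h2

lemma nat_mul_rate_sq {α : ℝ} {n : ℕ} (hn : 1 ≤ n) :
    n * rate α n ^ 2 = (n : ℝ) ^ (1 - 2 * α) * Real.log n := by
  have hn0 : (0 : ℝ) < n := by exact_mod_cast hn
  rw [rate_sq, Real.rpow_sub hn0, Real.rpow_one]; ring

lemma eventually_inv_le_rate {α : ℝ} (hα : α ≤ 1 / 2) :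
    ∀ᶠ n : ℕ in atTop, (n : ℝ)⁻¹ ≤ rate α n := by
  filter_upwards [(Real.tendsto_log_atTop.comp tendsto_natCast_atTop_atTop).eventually_ge_atTop 1,
    eventually_ge_atTop 1] with n hlog hn
  have hn0 : (1 : ℝ) ≤ n := by exact_mod_cast hn
  have hlog' : 1 ≤ Real.log n := hlog
  refine Real.le_sqrt_of_sq_le ?_
  have h1 : (n : ℝ) ^ (2 * α) ≤ n := by
    calc _ ≤ (n : ℝ) ^ (1 : ℝ) := Real.rpow_le_rpow_of_exponent_le hn0 (by linarith)
      _ = n := Real.rpow_one _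
  calc ((n : ℝ)⁻¹) ^ 2 ≤ (n : ℝ)⁻¹ := by
        have := inv_le_one_of_one_le₀ hn0
        have h0 : 0 ≤ (n : ℝ)⁻¹ := by positivity
        nlinarith
    _ = 1 / (n : ℝ) := (one_div _).symm
    _ ≤ _ := by gcongr

lemma log_le_nat_mul_rate_sq {α : ℝ} (hα : α ≤ 1 / 2) {n : ℕ} (hn : 1 ≤ n) :
    Real.log n ≤ n * rate α n ^ 2 := by
  have hn0 : (1 : ℝ) ≤ n := by exact_mod_cast hn
  rw [nat_mul_rate_sq hn]
  exact le_mul_of_one_le_left (Real.log_natCast_nonneg n)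
    (Real.one_le_rpow hn0 (by linarith))

variable {α c : ℝ} {d : ℕ → ℕ}

lemma eventually_dim_le
    (hd : Tendsto (fun n : ℕ => (d n : ℝ) / (n : ℝ) ^ (1 - 2 * α)) atTop (𝓝 c)) :
    ∀ᶠ n : ℕ in atTop, (d n : ℝ) ≤ (c + 1) * (n : ℝ) ^ (1 - 2 * α) := by
  filter_upwards [hd.eventually_lt_const (show c < c + 1 by linarith), eventually_ge_atTop 1]
    with n hn hn1
  have hn0 : (0 : ℝ) < n := by exact_mod_cast hn1
  rw [div_lt_iff₀ (by positivity)] at hn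
  exact hn.le

lemma eventually_dim_mul_log_le
    (hd : Tendsto (fun n : ℕ => (d n : ℝ) / (n : ℝ) ^ (1 - 2 * α)) atTop (𝓝 c)) :
    ∀ᶠ n : ℕ in atTop, d n * Real.log n ≤ (c + 1) * (n * rate α n ^ 2) := by
  filter_upwards [eventually_dim_le hd, eventually_ge_atTop 1] with n hn hn1
  rw [nat_mul_rate_sq hn1, ← mul_assoc]
  exact mul_le_mul_of_nonneg_right hn (Real.log_natCast_nonneg n)

lemma eventually_dim_le_self (hα : 0 < α)
    (hd : Tendsto (fun n : ℕ => (d n : ℝ) / (n : ℝ) ^ (1 - 2 * α)) atTop (𝓝 c)) :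
    ∀ᶠ n : ℕ in atTop, d n ≤ n := by
  have h1 : Tendsto (fun n : ℕ => (n : ℝ) ^ (2 * α)) atTop atTop :=
    (tendsto_rpow_atTop (show 0 < 2 * α by positivity)).comp tendsto_natCast_atTop_atTop
  filter_upwards [eventually_dim_le hd, h1.eventually_ge_atTop (c + 1), eventually_ge_atTop 1]
    with n hn hc hn1
  have hn0 : (0 : ℝ) < n := by exact_mod_cast hn1
  have h2 : (c + 1) * (n : ℝ) ^ (1 - 2 * α) ≤ n := by
    calc _ ≤ (n : ℝ) ^ (2 * α) * (n : ℝ) ^ (1 - 2 * α) := by gcongr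
      _ = n := by rw [← Real.rpow_add hn0]; simp
  exact_mod_cast hn.trans h2

lemma grid_card_le {m n : ℕ} (hn : 2 ≤ n) (hm : m ≤ n) {b : ℝ} (hb : m * Real.log n ≤ b) :
    (((2 * (m * n) + 1) ^ m : ℕ) : ℝ) ≤ Real.exp (4 * b) := by
  have hn0 : (0 : ℝ) < n := by
    have : 0 < n := by omega
    exact_mod_cast this
  have h1 : 2 * (m * n) + 1 ≤ n ^ 4 := by
    calc 2 * (m * n) + 1 ≤ 2 * (n * n) + 1 := by gcongr
      _ ≤ n ^ 4 := by nlinarith [Nat.mul_le_mul hn hn]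
  calc (((2 * (m * n) + 1) ^ m : ℕ) : ℝ) ≤ (((n ^ 4) ^ m : ℕ) : ℝ) := by
        exact_mod_cast Nat.pow_le_pow_left h1 m
    _ = Real.exp (Real.log n * (4 * m)) := by
        rw [Real.exp_mul, Real.exp_log hn0]; push_cast
        rw [← pow_mul, ← Real.rpow_natCast]; push_cast; ring_nf
    _ ≤ Real.exp (4 * b) := Real.exp_le_exp.2 (by linarith)

end Rate

/-! ### Almost sure linearization -/

section Asymptotic

variable {H : Type*} [NormedAddCommGroup H] [InnerProductSpace ℝ H] [MeasurableSpace H]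
  [BorelSpace H] {μ : Measure H} [IsProbabilityMeasure μ] {φ : ℕ → H} {d : ℕ → ℕ} {u : H}
  {Ω : Type*} [MeasurableSpace Ω] {P : Measure Ω} [IsProbabilityMeasure P] {X : ℕ → Ω → H}
  {α c C K κ L L₀ L₁ : ℝ}

/-- With constants chosen large enough, the event `NetClose` on a ball whose radius is a multiple
of the rate fails with probability at most `3 n⁻²`. The logarithm of the size of the net
is of the same order `n · rate²` as the exponents in the Bernstein bounds. -/
lemma eventually_exists_net (hX : ∀ i, HasLaw (X i) μ P) (hindep : iIndepFun X P)
    (hd_pos : ∀ n, 1 ≤ d n) (hα : 0 < α) (hα2 : α ≤ 1 / 2) (hc : 0 < c)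
    (hd : Tendsto (fun n : ℕ => (d n : ℝ) / (n : ℝ) ^ (1 - 2 * α)) atTop (𝓝 c))
    (hK0 : 0 ≤ K) (hU : ∀ᶠ n in atTop, UniformBounds μ φ (d n) u C K κ) (hL : 0 < L)
    (hL₀ : 8 * (c + 1) + 2 ≤ L₀ - 4) (hL₁ : 8 * (c + 1) + 2 ≤ L₁ / 8 - L ^ 2 * K) :
    ∀ᶠ n in atTop, ∀ Q : Zspan φ (d n), IsPopQuantile μ φ (d n) u Q →
      ∃ T : Finset (Zspan φ (d n)), (∀ v ∈ T, ‖v‖ ≤ 2) ∧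
        (∀ v : Zspan φ (d n), ‖v‖ ≤ 1 → ∃ w ∈ T, ‖v - w‖ ≤ (n : ℝ)⁻¹) ∧
        P.real {ω | ¬ NetClose μ (trunc φ (d n)) n (fun i => X i ω) T Q (L * rate α n)
          (L * rate α n / n) (L₀ * rate α n) (L₁ * rate α n ^ 2)} ≤ 3 * ((n : ℝ) ^ 2)⁻¹ := by
  have hr := tendsto_rate hα
  have hr4 : ∀ᶠ n in atTop, rate α n ≤ 1 / 4 :=
    (hr.eventually_lt_const (by norm_num)).mono fun _ => le_of_lt
  have hrL : ∀ᶠ n in atTop, L * rate α n ≤ 1 / 2 := by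
    have := hr.const_mul L
    rw [mul_zero] at this
    exact (this.eventually_lt_const (by norm_num)).mono fun _ => le_of_lt
  filter_upwards [hU, hr4, hrL, eventually_inv_le_rate hα2, eventually_dim_mul_log_le hd,
    eventually_dim_le_self hα hd, eventually_ge_atTop 2] with n hUn h4 hLn hinv hdlog hdn hn2 Q hQ
  have hn1 : 1 ≤ n := by omega
  have hn0 : (0 : ℝ) < n := by exact_mod_cast hn1
  have hδ : 0 < rate α n := (inv_pos.2 hn0).trans_le hinv
  obtain ⟨T, hT2, hTnet, hTcard⟩ := exists_finset_net (E := Zspan φ (d n)) (hd_pos n)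
    (finrank_Zspan_le φ (d n)) hn1
  refine ⟨T, hT2, hTnet, ?_⟩
  have hlog := log_le_nat_mul_rate_sq hα2 hn1
  set δ := rate α n with hδdef
  set b : ℝ := n * δ ^ 2 with hb
  have hb0 : 0 ≤ b := by positivity
  have hcard : (T.card : ℝ) ≤ Real.exp (4 * ((c + 1) * b)) :=
    (Nat.cast_le.2 hTcard).trans (grid_card_le hn2 hdn hdlog)
  have h := measureReal_not_netClose_le (l := δ) (A := (8 * (c + 1) + 2) * b)
    (t₀ := L₀ * δ) (t₁ := L₁ * δ ^ 2) (η := L * δ / n) hX hindep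
    (stronglyMeasurable_trunc φ (d n)) hUn.moment hK0 hT2 (show 0 < L * δ by positivity)
    (by linarith [hUn.norm_le Q hQ]) (by positivity)
    (div_le_self (by positivity) (by exact_mod_cast hn1)) hn1 hδ.le h4 hcard
    (Real.one_le_exp (by positivity))
    (by
      calc _ ≤ (L₁ / 8 - L ^ 2 * K) * b := by gcongr
        _ = _ := by rw [hb]; ring)
    (by
      calc _ ≤ (L₀ - 4) * b := by gcongr
        _ = _ := by rw [hb]; ring)
  refine h.trans ?_
  rw [mul_assoc, ← Real.exp_nat_mul, ← Real.exp_add]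
  gcongr
  calc _ = Real.exp (-(2 * b)) := by congr 1; push_cast; ring
    _ ≤ Real.exp (-(2 * Real.log n)) := Real.exp_le_exp.2 (by linarith)
    _ = ((n : ℝ) ^ 2)⁻¹ := by
        rw [Real.exp_neg, mul_comm, Real.exp_mul, Real.exp_log hn0, Real.rpow_ofNat]

/-- The Borel-Cantelli lemma for events of probability at least `1 - 3 n⁻²`. -/
lemma ae_eventually_of_measureReal_le {p : ℕ → Ω → Prop}
    (hp : ∀ᶠ n : ℕ in atTop, P.real {ω | ¬ p n ω} ≤ 3 * ((n : ℝ) ^ 2)⁻¹) :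
    ∀ᵐ ω ∂P, ∀ᶠ n in atTop, p n ω := by
  obtain ⟨n₁, hn₁⟩ := eventually_atTop.1 hp
  set s : ℕ → Set Ω := fun n => {ω | n₁ ≤ n ∧ ¬ p n ω} with hs
  have hle : ∀ n, P (s n) ≤ ENNReal.ofReal (3 * ((n : ℝ) ^ 2)⁻¹) := by
    intro n
    by_cases hn : n₁ ≤ n
    · have h1 : s n = {ω | ¬ p n ω} := by ext ω; simp [hs, hn]
      rw [h1, ← ofReal_measureReal]
      exact ENNReal.ofReal_le_ofReal (hn₁ n hn)
    · have h1 : s n = ∅ := by ext ω; simp [hs, hn]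
      rw [h1, measure_empty]; exact zero_le
  have hsum : Summable fun n : ℕ => 3 * ((n : ℝ) ^ 2)⁻¹ :=
    (Real.summable_nat_pow_inv.2 one_lt_two).mul_left 3
  have htsum : ∑' n, P (s n) ≠ ∞ :=
    ((ENNReal.tsum_le_tsum hle).trans_lt hsum.tsum_ofReal_lt_top).ne
  filter_upwards [ae_eventually_notMem htsum] with ω hω
  filter_upwards [hω, eventually_ge_atTop n₁] with n hn hn1
  by_contra hc
  exact hn ⟨hn1, hc⟩

/-- Almost surely, for all large `n`, every sample quantile is within the order `rate²` of the
Newton step from the population quantile. -/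
lemma exists_ae_eventually_norm_linearization_le (hX : ∀ i, HasLaw (X i) μ P)
    (hindep : iIndepFun X P)
    (hd_pos : ∀ n, 1 ≤ d n) (hα : 0 < α) (hα2 : α ≤ 1 / 2) (hc : 0 < c)
    (hd : Tendsto (fun n : ℕ => (d n : ℝ) / (n : ℝ) ^ (1 - 2 * α)) atTop (𝓝 c))
    (hK0 : 0 ≤ K) (hκ : 0 < κ) (hU : ∀ᶠ n in atTop, UniformBounds μ φ (d n) u C K κ)
    {Qn : (n : ℕ) → Zspan φ (d n)} (hQn : ∀ᶠ n in atTop, IsPopQuantile μ φ (d n) u (Qn n)) :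
    ∃ D : ℝ, ∀ᵐ ω ∂P, ∀ᶠ n in atTop, ∀ Qhat : Zspan φ (d n),
      IsSampleQuantile φ (d n) u n (fun i => X i ω) Qhat →
        ‖meanHessian μ (trunc φ (d n)) (Qn n) (Qhat - Qn n)
          + (empSgn n (fun i => trunc φ (d n) (X i ω)) (Qn n) - trunc φ (d n) u)‖
        ≤ D * rate α n ^ 2 := by
  -- `L₀` and `L₁` make the exponents in the Bernstein bounds dominate the size of the net; `L`
  -- makes strong monotonicity on the sphere of radius `L δ` dominate the fluctuation at its centre
  set L₀ : ℝ := 8 * (c + 1) + 6 with hL₀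
  set L : ℝ := (2 * L₀ + 1) / κ with hLdef
  set L₁ : ℝ := 8 * (8 * (c + 1) + 2 + L ^ 2 * K) with hL₁
  have hL : 0 < L := by positivity
  have hκL : κ * L = 2 * L₀ + 1 := by rw [hLdef]; field_simp
  refine ⟨4 * L ^ 2 * K + 5 * (L₁ + L * (1 + K)), ?_⟩
  have hnet := eventually_exists_net (L₀ := L₀) (L₁ := L₁) hX hindep hd_pos hα hα2 hc hd hK0 hU hL
    (by rw [hL₀]; linarith) (by rw [hL₁]; linarith)
  have hr := tendsto_rate hα
  have hrL : ∀ᶠ n in atTop, L * rate α n ≤ 1 / 2 := by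
    have := hr.const_mul L
    rw [mul_zero] at this
    exact (this.eventually_lt_const (by norm_num)).mono fun _ => le_of_lt
  have hrsmall : ∀ᶠ n in atTop, (4 * L₁ + 4 * (L * (1 + K))) * rate α n < 1 := by
    have := hr.const_mul (4 * L₁ + 4 * (L * (1 + K)))
    rw [mul_zero] at this
    exact this.eventually_lt_const one_pos
  refine ae_eventually_of_measureReal_le ?_
  filter_upwards [hnet, hQn, hU, hrL, hrsmall, eventually_inv_le_rate hα2, eventually_ge_atTop 2]
    with n hnetn hQ hUn hLn hsmall hinv hn2
  obtain ⟨T, hT2, hT, hprob⟩ := hnetn (Qn n) hQ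
  refine (measureReal_mono (fun ω hω => ?_) (measure_ne_top _ _)).trans hprob
  rw [Set.mem_ofPred_eq] at hω ⊢
  refine fun hclose => hω fun Qhat hmin => ?_
  have hn0 : (0 : ℝ) < n := by
    have : 0 < n := by omega
    exact_mod_cast this
  have hδ : 0 < rate α n := (inv_pos.2 hn0).trans_le hinv
  set δ := rate α n
  have hY := stronglyMeasurable_trunc φ (d n)
  have hQC := hUn.norm_le _ hQ
  have hp : ∀ a ∈ T, ∫ s, sgnOsc (L * δ / n) (Qn n + (L * δ) • a - trunc φ (d n) s) ∂μ
      ≤ L * (1 + K) * δ ^ 2 := by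
    intro a ha
    refine (hUn.moment.integral_sgnOsc_le hK0 hY (by positivity) ?_).trans ?_
    · refine (norm_add_le _ _).trans ?_
      rw [norm_smul, Real.norm_of_nonneg (by positivity)]
      have : L * δ * ‖a‖ ≤ 1 / 2 * 2 := by
        gcongr
        exact hT2 a ha
      linarith
    · calc L * δ / n * (1 + K) = L * δ * (n : ℝ)⁻¹ * (1 + K) := by ring
        _ ≤ L * δ * δ * (1 + K) := by gcongr
        _ = _ := by ring
  have h := NetClose.norm_linearization_le (κ := κ) (w := trunc φ (d n) u) (Qhat := Qhat)
    hclose hY hT hn2 (by positivity) hp hUn.moment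
    hK0 (hQC.trans (by linarith)) (hUn.meanSgn_eq hK0 hQ)
    (fun Q hQ' => hUn.mono_of_isPopQuantile hQ (hQ'.trans (by linarith)))
    (by
      rw [← mul_assoc κ, hκL]
      nlinarith) hmin
  refine h.trans (le_of_eq ?_)
  ring

end Asymptotic

end SpatialQuantile

end

theorem theorem3p3
    {H : Type*} [NormedAddCommGroup H] [InnerProductSpace ℝ H] [CompleteSpace H]
    [TopologicalSpace.SeparableSpace H] [MeasurableSpace H] [BorelSpace H]
    {Ω : Type*} [MeasurableSpace Ω] (P : Measure Ω) [IsProbabilityMeasure P]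
    -- the common law and the i.i.d. observations
    (μ : Measure H) [IsProbabilityMeasure μ]
    (X : ℕ → Ω → H) (hX_law : ∀ i, HasLaw (X i) μ P) (hX_indep : iIndepFun X P)
    -- the orthonormal basis and the dimensions of the approximating subspaces
    (N : ℕ∞) (φ : ℕ → H) (hφ : IsOrthonormalBasisSeq N φ)
    (d : ℕ → ℕ) (hd_pos : ∀ n, 1 ≤ d n) (hd_le : ∀ n, (d n : ℕ∞) ≤ N)
    (u : H) (hu : ‖u‖ < 1)
    (hB : AssumptionB μ φ d)
    (α : ℝ) (hα_pos : 0 < α) (hα_le : α ≤ 1 / 2)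
    (c : ℝ) (hc : 0 < c)
    (hd : Tendsto (fun n : ℕ => (d n : ℝ) / (n : ℝ) ^ (1 - 2 * α)) atTop (𝓝 c)) :
    -- `Q_n(u)` exists and is unique for all large `n`; sample quantiles always exist
    (∀ᶠ n in atTop, ∃! Q : Zspan φ (d n), IsPopQuantile μ φ (d n) u Q) ∧
    (∀ n : ℕ, 1 ≤ n → ∀ ω, ∃ Q : Zspan φ (d n),
      IsSampleQuantile φ (d n) u n (fun i => X i ω) Q) ∧
    ∀ Qn : (n : ℕ) → Zspan φ (d n), (∀ᶠ n in atTop, IsPopQuantile μ φ (d n) u (Qn n)) →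
      -- for all large `n` the Hessian operator at `Q_n(u)` exists and is invertible
      ∃ J : (n : ℕ) → (Zspan φ (d n) ≃L[ℝ] Zspan φ (d n)),
        (∀ᶠ n in atTop, IsHessianOperator μ φ (d n) u (Qn n)
          (J n : Zspan φ (d n) →L[ℝ] Zspan φ (d n))) ∧
        -- the linear representation, for every choice of the sample quantiles
        ∀ Qhat : (n : ℕ) → Ω → Zspan φ (d n),
          (∀ᵐ ω ∂P, ∀ᶠ n in atTop,
            IsSampleQuantile φ (d n) u n (fun i => X i ω) (Qhat n ω)) →
          ∃ R : (n : ℕ) → Ω → Zspan φ (d n),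
            (∀ n : ℕ, 1 ≤ n → ∀ ω,
              Qhat n ω - Qn n =
                -((n : ℝ)⁻¹ • ∑ i ∈ Finset.range n,
                  (J n).symm (sgn (Qn n - trunc φ (d n) (X i ω)) - trunc φ (d n) u))
                + R n ω) ∧
            ∀ᵐ ω ∂P, (fun n : ℕ => ‖R n ω‖) =O[atTop]
              (fun n : ℕ => Real.log n / (n : ℝ) ^ (2 * α)) := by
  have hon : ∀ n, Orthonormal ℝ fun k : Fin (d n) => φ k := fun n => orthonormal_fin hφ (hd_le n)
  obtain ⟨C, K, κ, hK0, hκ, hU⟩ := hB.exists_uniformBounds hon hu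
  refine ⟨hU.mono fun n h => h.existsUnique, fun n hn ω => ?_, fun Qn hQn => ?_⟩
  · exact exists_forall_empObjective_le hn (fun i => trunc φ (d n) (X i ω))
      ((norm_trunc_le (hon n) u).trans_lt hu)
  classical
  -- the Hessian is invertible from some index on; before it the choice of `J n` is immaterial
  set J : (n : ℕ) → (Zspan φ (d n) ≃L[ℝ] Zspan φ (d n)) := fun n =>
    if h : ∃ J : Zspan φ (d n) ≃L[ℝ] Zspan φ (d n),
      (J : Zspan φ (d n) →L[ℝ] Zspan φ (d n)) = meanHessian μ (trunc φ (d n)) (Qn n)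
    then h.choose else ContinuousLinearEquiv.refl ℝ _ with hJdef
  have hJ : ∀ᶠ n in atTop, (J n : Zspan φ (d n) →L[ℝ] Zspan φ (d n))
      = meanHessian μ (trunc φ (d n)) (Qn n) := by
    filter_upwards [hU, hQn] with n hUn hQ
    have h := exists_equiv_of_coercive hκ (hUn.le_inner_meanHessian hK0 hQ)
    simp only [hJdef, dif_pos h]
    exact h.choose_spec
  refine ⟨J, ?_, fun Qhat hQhat => ?_⟩
  · filter_upwards [hU, hQn, hJ] with n hUn hQ hJn
    rw [hJn]
    exact isHessianOperator_meanHessian hUn.moment hK0 ((hUn.norm_le _ hQ).trans (by linarith))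
  -- the remainder is defined by the representation; the claim is its size
  refine ⟨fun n ω => Qhat n ω - Qn n + (n : ℝ)⁻¹ • ∑ i ∈ Finset.range n,
    (J n).symm (sgn (Qn n - trunc φ (d n) (X i ω)) - trunc φ (d n) u),
    fun n _ ω => by rw [eq_neg_add_iff_add_eq, add_comm], ?_⟩
  obtain ⟨D, hD⟩ := exists_ae_eventually_norm_linearization_le hX_law hX_indep hd_pos hα_pos hα_le
    hc hd hK0 hκ hU hQn
  filter_upwards [hD, hQhat] with ω hω hQω
  refine IsBigO.of_bound (κ⁻¹ * D) ?_
  filter_upwards [hω, hQω, hU, hQn, hJ, eventually_ge_atTop 1] with n hn hQhatn hUn hQ hJn hn1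
  have hn0 : (n : ℝ) ≠ 0 := by
    have : n ≠ 0 := by omega
    exact_mod_cast this
  have h1 := hn _ hQhatn
  rw [rate_sq] at h1
  rw [norm_norm, ← map_sum, ← map_smul]
  set R := Qhat n ω - Qn n + (J n).symm ((n : ℝ)⁻¹ • ∑ i ∈ Finset.range n,
    (sgn (Qn n - trunc φ (d n) (X i ω)) - trunc φ (d n) u)) with hR
  have h2 : meanHessian μ (trunc φ (d n)) (Qn n) R
      = meanHessian μ (trunc φ (d n)) (Qn n) (Qhat n ω - Qn n)
        + (empSgn n (fun i => trunc φ (d n) (X i ω)) (Qn n) - trunc φ (d n) u) := by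
    rw [hR, map_add, ← hJn, ContinuousLinearEquiv.coe_coe, ContinuousLinearEquiv.apply_symm_apply,
      Finset.sum_sub_distrib, smul_sub, Finset.sum_const, Finset.card_range,
      ← Nat.cast_smul_eq_nsmul ℝ, inv_smul_smul₀ hn0, empSgn]
  have h3 := mul_norm_le_norm_of_coercive (hUn.le_inner_meanHessian hK0 hQ) R
  rw [h2] at h3
  rw [Real.norm_of_nonneg (div_nonneg (Real.log_natCast_nonneg n) (by positivity)), mul_assoc]
  calc ‖R‖ ≤ κ⁻¹ * (κ * ‖R‖) := by rw [inv_mul_cancel_left₀ hκ.ne']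
    _ ≤ _ := mul_le_mul_of_nonneg_left (h3.trans h1) (inv_nonneg.2 hκ.le)
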